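/- Let $V:\mathbb R\to\mathbb R$ be the restriction of an entire function with $V(0)=0$, let $\mu>0$, $\beta\in\mathbb R$, and let $N\ge 1$ be an integer. Put $H(q,p)=\frac{p^2}{2\mu}+V(q)$ and $$A(q,p)=\beta\,\frac{(2N-1)!}{2^{N-1}\mu^{3(N-1)}}\left(\frac1{H(q,p)}\right)^{N}.$$ For $\hbar>0$, a solution of the time kernel equation means a $C^2$ function $T:\mathbb R^2\to\mathbb C$ with $$-\frac{\hbar^2}{2\mu}\frac{\partial^2T(q,q')}{\partial q^2}+\frac{\hbar^2}{2\mu}\frac{\partial^2T(q,q')}{\partial q'^2}+[V(q)-V(q')]\,T(q,q')=0\qquad\text{on }\mathbb R^2 .$$ (i) For every $\hbar>0$ there is exactly one solution $T$ with $$T(q,q)=\tfrac q2,\qquad T(q,-q)=-i^{2N-1}\beta\mu^{-2(N-1)}(2q)^{2N-1},$$ and exactly one solution $T_{\mathrm{TOA}}$ (the kernel factor of the time of arrival operator) with $T_{\mathrm{TOA}}(q,q)=\frac q2$, $T_{\mathrm{TOA}}(q,-q)=0$. Both are given by power series $\sum_{m,n\ge0}\alpha_{m,n}(q+q')^m(q-q')^n$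 converging on all of $\mathbb R^2$. Write $T=T_{\mathrm{TOA}}+T_C$. For a kernel $K$ such that $K(q+\frac v2,q-\frac v2)=\sum_n c_nv^n\operatorname{sgn}(v)$ for all real $v$, its Wigner–Weyl transform at $(q,p)$, formally $\int K(q+\frac v2,q-\frac v2)e^{-ivp/\hbar}\,dv$, is taken term by term: it is the series $\sum_n w_n$, where $w_n=\lim_{\varepsilon\to0^+}\int_{\mathbb R} e^{-\varepsilon|v|}c_nv^n\operatorname{sgn}(v)e^{-ivp/\hbar}\,dv$. Let $\mathcal T_{\hbar,C}(q,p)$ be the Wigner–Weyl transform of the kernel $\frac{\mu}{i\hbar}T_C(q,q')\operatorname{sgn}(q-q')$. Let $(q,p)$ satisfy $|V(q)|<\frac{p^2}{2\mu}$. (ii) If the system is linear, i.e. $V'$ is an affine function of $q$, then for every $\hbar>0$ the series $\mathcal T_{\hbar,C}(q,p)$ converges and $$\mathcal T_{\hbar,C}(q,p)=A(q,p)\,\hbar^{2N-1}.$$ (iii) For general $V$, every term of the series $\mathcal T_{\hbar,C}(q,p)$ is a polynomial in $\hbar$ whose coefficients do not depend on $\hbar$. For each $k$ the coefficients of $\hbar^k$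 of all the terms form a convergent series. The resulting formal power series in $\hbar$ satisfies $$\mathcal T_{\hbar,C}(q,p)=A(q,p)\,\hbar^{2N-1}+O(\hbar^{2N+1}),$$ that is, the difference of $\mathcal T_{\hbar,C}(q,p)$ and $A(q,p)\hbar^{2N-1}$ is divisible by $\hbar^{2N+1}$. -/

import Mathlib

open Filter Topology

noncomputable section

/-- An entire potential: the restriction to the real line of an entire function, real valued
on the real line. -/
def IsEntirePotential (V : ℝ → ℝ) : Prop :=
  ∃ f : ℂ → ℂ, Differentiable ℂ f ∧ ∀ x : ℝ, f (x : ℂ) = (V x : ℂ)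

/-- A linear system: the equation of motion `μ q̈ = -V'(q)` is linear, i.e. the force is
an affine function of the position. -/
def IsLinearSystem (V : ℝ → ℝ) : Prop :=
  ∃ k b : ℝ, ∀ q : ℝ, deriv V q = k * q + b

/-- The classical Hamiltonian `H(q,p) = p² / (2μ) + V(q)`. -/
def hamiltonian (μ : ℝ) (V : ℝ → ℝ) (q p : ℝ) : ℝ := p ^ 2 / (2 * μ) + V q

/-- `T` is a (classical, i.e. twice continuously differentiable) solution on the whole plane of
the time kernel equation
`-(ħ²/2μ) ∂²T/∂x² + (ħ²/2μ) ∂²T/∂y² + (V(x) - V(y)) T = 0`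
with the boundary conditions `T(x,x) = f(x)` and `T(x,-x) = g(x)`. -/
structure IsTimeKernelSolution (ħ μ : ℝ) (V : ℝ → ℝ) (f g : ℝ → ℂ) (T : ℝ → ℝ → ℂ) : Prop where
  contDiff : ContDiff ℝ 2 (fun z : ℝ × ℝ => T z.1 z.2)
  equation : ∀ x y : ℝ,
    -((ħ : ℂ) ^ 2 / (2 * (μ : ℂ))) * iteratedDeriv 2 (fun s : ℝ => T s y) x
      + ((ħ : ℂ) ^ 2 / (2 * (μ : ℂ))) * iteratedDeriv 2 (fun s : ℝ => T x s) y
      + ((V x : ℂ) - (V y : ℂ)) * T x y = 0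
  diag : ∀ x : ℝ, T x x = f x
  antidiag : ∀ x : ℝ, T x (-x) = g x

/-- `T` is the one and only solution of the time kernel equation with the given boundary
conditions. -/
def IsTheTimeKernelSolution (ħ μ : ℝ) (V : ℝ → ℝ) (f g : ℝ → ℂ) (T : ℝ → ℝ → ℂ) : Prop :=
  IsTimeKernelSolution ħ μ V f g T ∧ ∀ S, IsTimeKernelSolution ħ μ V f g S → S = T

/-- `T(x,y) = ∑_{m,n} α_{m,n} (x+y)^m (x-y)^n` on the whole plane. -/
def HasKernelPowerSeries (T : ℝ → ℝ → ℂ) : Prop :=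
  ∃ α : ℕ × ℕ → ℂ, ∀ x y : ℝ,
    HasSum (fun k : ℕ × ℕ => α k * ((x + y : ℝ) : ℂ) ^ k.1 * ((x - y : ℝ) : ℂ) ^ k.2) (T x y)

/-- The boundary value `T(x,x) = x/2`. -/
def diagData (x : ℝ) : ℂ := (x : ℂ) / 2

/-- The boundary value `T(x,-x) = -i^{2N-1} β μ^{-2(N-1)} (2x)^{2N-1}`, for `N ≥ 1`. -/
def antidiagData (μ β : ℝ) (N : ℕ) (x : ℝ) : ℂ :=
  -(Complex.I ^ (2 * N - 1) * (β : ℂ) / (μ : ℂ) ^ (2 * (N - 1)) * (2 * (x : ℂ)) ^ (2 * N - 1))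

/-- `T` is the kernel factor of the time of arrival operator (arrival at the origin): the
solution of the time kernel equation with `T(x,x) = x/2` and `T(x,-x) = 0`. -/
def IsTimeOfArrivalKernel (ħ μ : ℝ) (V : ℝ → ℝ) (T : ℝ → ℝ → ℂ) : Prop :=
  IsTheTimeKernelSolution ħ μ V diagData (fun _ => 0) T

/-- The operator kernel `⟨x|𝒯|y⟩ = (μ/iħ) T(x,y) sgn(x-y)` with kernel factor `T`. -/
def operatorKernel (ħ μ : ℝ) (T : ℝ → ℝ → ℂ) (x y : ℝ) : ℂ :=
  (μ : ℂ) / (Complex.I * (ħ : ℂ)) * T x y * (Real.sign (x - y) : ℂ)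

/-- The (generally only conditionally defined) integral of `f` over the real line has the value
`L` in the sense of Abel: `L = lim_{ε → 0+} ∫ exp(-ε|v|) f(v) dv`. -/
def HasAbelIntegral (f : ℝ → ℂ) (L : ℂ) : Prop :=
  (∀ ε : ℝ, 0 < ε → MeasureTheory.Integrable (fun v : ℝ => (Real.exp (-ε * |v|) : ℂ) * f v)) ∧
    Tendsto (fun ε : ℝ => ∫ v : ℝ, (Real.exp (-ε * |v|) : ℂ) * f v) (𝓝[>] 0) (𝓝 L)

/-- `w` is the sequence of terms of the Wigner-Weyl transform
`∫ K(q + v/2, q - v/2) exp(-i v p / ħ) dv` of the kernel `K` at `(q,p)`, taken term by term: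
`K(q + v/2, q - v/2) = ∑_n c_n v^n sgn(v)` for all real `v`, and `w n` is the integral of
`c_n v^n sgn(v) exp(-i v p / ħ)`. -/
def HasWignerWeylTerms (K : ℝ → ℝ → ℂ) (ħ q p : ℝ) (w : ℕ → ℂ) : Prop :=
  ∃ c : ℕ → ℂ,
    (∀ v : ℝ, HasSum (fun n : ℕ => c n * (v : ℂ) ^ n * (Real.sign v : ℂ))
      (K (q + v / 2) (q - v / 2))) ∧
    ∀ n : ℕ, HasAbelIntegral
      (fun v : ℝ => c n * (v : ℂ) ^ n * (Real.sign v : ℂ) *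
        Complex.exp (-Complex.I * (v : ℂ) * (p : ℂ) / (ħ : ℂ))) (w n)

/-- The termwise Wigner-Weyl transform of `K` at `(q,p)` converges and has the value `L`. -/
def HasWignerWeyl (K : ℝ → ℝ → ℂ) (ħ q p : ℝ) (L : ℂ) : Prop :=
  ∃ w : ℕ → ℂ, HasWignerWeylTerms K ħ q p w ∧ HasSum w L

/-- The power series `W` in `ħ` is the expansion in powers of `ħ` of the termwise Wigner-Weyl
transform at `(q,p)` of the family of kernels `K ħ`, `ħ > 0`: every term of the transform is a
polynomial in `ħ`, and for each `k` the coefficients of `ħ^k` of all the terms sum up to the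
coefficient of `ħ^k` of `W`. -/
def HasWignerWeylExpansion (K : ℝ → ℝ → ℝ → ℂ) (q p : ℝ) (W : PowerSeries ℂ) : Prop :=
  ∃ P : ℕ → Polynomial ℂ,
    (∀ ħ : ℝ, 0 < ħ → HasWignerWeylTerms (K ħ) ħ q p (fun n => (P n).eval (ħ : ℂ))) ∧
    ∀ k : ℕ, HasSum (fun n => (P n).coeff k) (PowerSeries.coeff k W)

/-- The coefficient of `ħ^{2N-1}` in the shift:
`β (2N-1)! / (2^{N-1} μ^{3(N-1)}) · (1/H(q,p))^N`. -/
def shiftCoeff (μ β : ℝ) (N : ℕ) (V : ℝ → ℝ) (q p : ℝ) : ℝ :=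
  β * (Nat.factorial (2 * N - 1) : ℝ) / (2 ^ (N - 1) * μ ^ (3 * (N - 1))) *
    (1 / hamiltonian μ V q p) ^ N

end

/-! In the variables u = x + y, v = x - y, with U(z) = V(z/2), the time kernel equation is a Goursat
problem ∂²F/∂u∂v = Λ w F, where Λ = μ/ħ² and w = (U(u+v) - U(u-v))/2, with data on the axes v = 0
and u = 0. Sorting F = ∑ aₙ(u) vⁿ by rows makes it a recursion for the aₙ. Its solutions are entire
(`IsGoursatSeries.isEntireDouble`), and a weighted maximum estimate gives uniqueness among C²
functions (`eq_zero_of_goursat`).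

The difference T_C vanishes on v = 0 and is c v^(2M+1) on u = 0, with N = M + 1. The transform sends
vⁿ sgn v to a multiple of n! (ħ/p)^(n+1). Stripped of these factorials, the recursion for the rows
of T_C becomes the Moyal equation for a series in negative powers of a rescaled formal momentum p,
graded by ħ². Its leading term is Q^(-(M+1)) with Q = p² - 2U, a function of the energy. Each
correction D_s of order ħ^(2s) solves a transport equation whose source involves derivatives of U of
order at least 3.

Since Q is annihilated by the transport operator, every D_s is a finite sum of e(u) Q^(-(M+1+k))
with e entire (`moyalTerm_mem`). So each D_s converges where the leading negative binomial series
does, that is for |V| < p²/2μ. Counting powers, D_s contributes exactly to ħ^(2M+1+2s)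
(`eval_termPoly`). Hence D₀ gives the stated leading coefficient and the next power of ħ is two
higher. If V' is affine, all corrections vanish and the formula is exact. -/

noncomputable section

namespace TimeKernel

open PowerSeries Finset.HasAntidiagonal MeasureTheory

/-! ### Entire power series in one variable. -/

/-- A formal power series with complex coefficients that converges on the whole plane. -/
def IsEntireSeries (f : ℂ⟦X⟧) : Prop := ∀ x : ℂ, Summable fun n => coeff n f * x ^ n

/-- The sum of a power series. -/
def evalSeries (x : ℂ) (f : ℂ⟦X⟧) : ℂ := ∑' n, coeff n f * x ^ n

/-- The antiderivative without constant term. -/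
def antideriv (f : ℂ⟦X⟧) : ℂ⟦X⟧ :=
  PowerSeries.mk fun n => if n = 0 then 0 else coeff (n - 1) f / n

theorem IsEntireSeries.hasSum {f : ℂ⟦X⟧} (hf : IsEntireSeries f) (x : ℂ) :
    HasSum (fun n => coeff n f * x ^ n) (evalSeries x f) := (hf x).hasSum

theorem constantCoeff_antideriv (f : ℂ⟦X⟧) : constantCoeff (antideriv f) = 0 := by
  rw [← coeff_zero_eq_constantCoeff_apply]
  simp [antideriv]

theorem derivative_antideriv (f : ℂ⟦X⟧) : d⁄dX ℂ (antideriv f) = f := by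
  ext n
  have : (n : ℂ) + 1 ≠ 0 := by exact_mod_cast n.succ_ne_zero
  rw [coeff_derivative]
  simp [antideriv, this]

theorem IsEntireSeries.zero : IsEntireSeries 0 := fun x => by
  simp [summable_zero]

theorem evalSeries_zero (x : ℂ) : evalSeries x 0 = 0 := by simp [evalSeries]

theorem hasSum_polynomial (p : Polynomial ℂ) (x : ℂ) :
    HasSum (fun n => coeff n (p : ℂ⟦X⟧) * x ^ n) (p.eval x) := by
  rw [Polynomial.eval_eq_sum, Polynomial.sum]
  simp only [Polynomial.coeff_coe]
  refine hasSum_sum_of_ne_finset_zero fun n hn => ?_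
  rw [Polynomial.notMem_support_iff.1 hn, zero_mul]

theorem IsEntireSeries.polynomial (p : Polynomial ℂ) : IsEntireSeries (p : ℂ⟦X⟧) :=
  fun x => (hasSum_polynomial p x).summable

theorem evalSeries_polynomial (p : Polynomial ℂ) (x : ℂ) :
    evalSeries x (p : ℂ⟦X⟧) = p.eval x := (hasSum_polynomial p x).tsum_eq

theorem IsEntireSeries.C (c : ℂ) : IsEntireSeries (C c) := by
  simpa using IsEntireSeries.polynomial (Polynomial.C c)

theorem evalSeries_C (x c : ℂ) : evalSeries x (C c) = c := by
  simpa using evalSeries_polynomial (Polynomial.C c) x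

theorem IsEntireSeries.add {f g : ℂ⟦X⟧} (hf : IsEntireSeries f) (hg : IsEntireSeries g) :
    IsEntireSeries (f + g) := fun x => by
  simpa [add_mul] using (hf x).add (hg x)

theorem evalSeries_add {f g : ℂ⟦X⟧} (hf : IsEntireSeries f) (hg : IsEntireSeries g) (x : ℂ) :
    evalSeries x (f + g) = evalSeries x f + evalSeries x g := by
  simp only [evalSeries, map_add, add_mul]
  exact (hf x).tsum_add (hg x)

theorem coeff_mul_mul_pow (f g : ℂ⟦X⟧) (x : ℂ) (n : ℕ) :
    coeff n (f * g) * x ^ n =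
      ∑ k ∈ antidiagonal n, (coeff k.1 f * x ^ k.1) * (coeff k.2 g * x ^ k.2) := by
  rw [coeff_mul, Finset.sum_mul]
  refine Finset.sum_congr rfl fun k hk => ?_
  rw [← Finset.HasAntidiagonal.mem_antidiagonal.1 hk, pow_add]
  ring

theorem IsEntireSeries.mul {f g : ℂ⟦X⟧} (hf : IsEntireSeries f) (hg : IsEntireSeries g) :
    IsEntireSeries (f * g) := fun x => by
  simp only [coeff_mul_mul_pow]
  exact (summable_norm_sum_mul_antidiagonal_of_summable_norm (hf x).norm (hg x).norm).of_norm

theorem evalSeries_mul {f g : ℂ⟦X⟧} (hf : IsEntireSeries f) (hg : IsEntireSeries g) (x : ℂ) :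
    evalSeries x (f * g) = evalSeries x f * evalSeries x g := by
  simp only [evalSeries, coeff_mul_mul_pow]
  exact (tsum_mul_tsum_eq_tsum_sum_antidiagonal_of_summable_norm (hf x).norm (hg x).norm).symm

theorem IsEntireSeries.smul {f : ℂ⟦X⟧} (hf : IsEntireSeries f) (c : ℂ) :
    IsEntireSeries (c • f) := by
  rw [smul_eq_C_mul]; exact (IsEntireSeries.C c).mul hf

theorem evalSeries_smul {f : ℂ⟦X⟧} (hf : IsEntireSeries f) (c x : ℂ) :
    evalSeries x (c • f) = c * evalSeries x f := by
  rw [smul_eq_C_mul, evalSeries_mul (IsEntireSeries.C c) hf, evalSeries_C]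

theorem IsEntireSeries.pow {f : ℂ⟦X⟧} (hf : IsEntireSeries f) (n : ℕ) :
    IsEntireSeries (f ^ n) := by
  induction n with
  | zero => simpa using IsEntireSeries.C 1
  | succ n ih => rw [pow_succ]; exact ih.mul hf

theorem evalSeries_pow {f : ℂ⟦X⟧} (hf : IsEntireSeries f) (n : ℕ) (x : ℂ) :
    evalSeries x (f ^ n) = evalSeries x f ^ n := by
  induction n with
  | zero => simpa using evalSeries_C x 1
  | succ n ih => rw [pow_succ, evalSeries_mul (hf.pow n) hf, ih, pow_succ]

theorem IsEntireSeries.sum {ι : Type*} {s : Finset ι} {f : ι → ℂ⟦X⟧}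
    (hf : ∀ i ∈ s, IsEntireSeries (f i)) : IsEntireSeries (∑ i ∈ s, f i) :=
  Finset.sum_induction _ _ (fun _ _ => IsEntireSeries.add) IsEntireSeries.zero hf

theorem evalSeries_sum {ι : Type*} {s : Finset ι} {f : ι → ℂ⟦X⟧}
    (hf : ∀ i ∈ s, IsEntireSeries (f i)) (x : ℂ) :
    evalSeries x (∑ i ∈ s, f i) = ∑ i ∈ s, evalSeries x (f i) := by
  classical
  induction s using Finset.induction_on with
  | empty => simp [evalSeries_zero]
  | insert i s hi ih =>
    rw [Finset.sum_insert hi, Finset.sum_insert hi, evalSeries_add, ih]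
    · exact fun j hj => hf j (Finset.mem_insert_of_mem hj)
    · exact hf i (Finset.mem_insert_self _ _)
    · exact IsEntireSeries.sum fun j hj => hf j (Finset.mem_insert_of_mem hj)

theorem succ_le_two_pow (n : ℕ) : (n : ℝ) + 1 ≤ 2 ^ n := by
  exact_mod_cast (Nat.lt_two_pow_self : n < 2 ^ n)

theorem norm_natCast_add_one (n : ℕ) : ‖(n : ℂ) + 1‖ = n + 1 := by
  rw [show (n : ℂ) + 1 = ((n + 1 : ℕ) : ℂ) by push_cast; rfl, Complex.norm_natCast]
  push_cast; rfl

theorem IsEntireSeries.derivative {f : ℂ⟦X⟧} (hf : IsEntireSeries f) :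
    IsEntireSeries (d⁄dX ℂ f) := fun x => by
  -- The doubling absorbs the factor n + 1 ≤ 2ⁿ of the derivative; the added 1 keeps r invertible at
  -- x = 0.
  set r : ℝ := 2 * ‖x‖ + 1
  have hr : 0 < r := by positivity
  have h1 := ((summable_nat_add_iff 1).2 (hf r).norm).mul_left r⁻¹
  refine Summable.of_norm_bounded h1 fun n => ?_
  rw [coeff_derivative, norm_mul, norm_mul, norm_mul, norm_pow, norm_pow, norm_natCast_add_one, Complex.norm_real,
    Real.norm_of_nonneg hr.le, pow_succ]
  have h3 : ((n : ℝ) + 1) * ‖x‖ ^ n ≤ r ^ n := by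
    calc ((n : ℝ) + 1) * ‖x‖ ^ n ≤ 2 ^ n * ‖x‖ ^ n := by gcongr; exact succ_le_two_pow n
      _ = (2 * ‖x‖) ^ n := by rw [mul_pow]
      _ ≤ r ^ n := by gcongr; simp [r]
  calc _ = ‖coeff (n + 1) f‖ * (((n : ℝ) + 1) * ‖x‖ ^ n) := by ring
    _ ≤ ‖coeff (n + 1) f‖ * r ^ n := by gcongr
    _ = _ := by field_simp

theorem IsEntireSeries.antideriv {f : ℂ⟦X⟧} (hf : IsEntireSeries f) :
    IsEntireSeries (antideriv f) := fun x => by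
  rw [← summable_nat_add_iff 1]
  refine Summable.of_norm_bounded ((hf x).norm.mul_left ‖x‖) fun n => ?_
  simp only [TimeKernel.antideriv, coeff_mk, Nat.add_eq_zero_iff, one_ne_zero, and_false, if_false,
    Nat.add_sub_cancel, norm_mul, norm_div, norm_pow, Nat.cast_add, Nat.cast_one,
    norm_natCast_add_one]
  have : ‖coeff n f‖ / ((n : ℝ) + 1) ≤ ‖coeff n f‖ :=
    div_le_self (norm_nonneg _) (by linarith [n.cast_nonneg (α := ℝ)])
  calc _ ≤ ‖coeff n f‖ * ‖x‖ ^ (n + 1) := by gcongr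
    _ = _ := by ring

theorem hasDerivAt_evalSeries {f : ℂ⟦X⟧} (hf : IsEntireSeries f) (x : ℂ) :
    HasDerivAt (fun z => evalSeries z f) (evalSeries x (d⁄dX ℂ f)) x := by
  set r : ℝ := ‖x‖ + 1
  have hr : 0 < r := by positivity
  have hu : Summable fun n : ℕ => ‖coeff n f * (n : ℂ) * (r : ℂ) ^ (n - 1)‖ := by
    rw [← summable_nat_add_iff 1]
    refine ((hf.derivative r).norm).congr fun n => ?_
    rw [coeff_derivative]; simp
  have key := hasDerivAt_tsum_of_isPreconnected (𝕜 := ℂ)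
    (g := fun n z => coeff n f * z ^ n)
    (g' := fun n z => coeff n f * ((n : ℂ) * z ^ (n - 1))) hu
    (Metric.isOpen_ball (x := (0 : ℂ)) (ε := r)) (convex_ball _ _).isPreconnected
    (fun n z _ => (hasDerivAt_pow n z).const_mul _) (fun n z hz => ?_)
    (Metric.mem_ball_self hr) (hf 0) (y := x) (by simp [r])
  · have hs : Summable fun n : ℕ => coeff n f * ((n : ℂ) * x ^ (n - 1)) := by
      rw [← summable_nat_add_iff 1]
      refine (hf.derivative x).congr fun n => ?_
      rw [coeff_derivative]; simp [mul_assoc]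
    have he : evalSeries x (d⁄dX ℂ f) = ∑' n : ℕ, coeff n f * ((n : ℂ) * x ^ (n - 1)) := by
      rw [hs.tsum_eq_zero_add]
      simp [evalSeries, coeff_derivative, mul_assoc]
    rw [he]
    exact key
  · have : ‖z‖ ≤ r := by simpa using (Metric.mem_ball.1 hz).le
    rw [← mul_assoc, norm_mul _ (z ^ _), norm_mul _ ((r : ℂ) ^ _), norm_pow, norm_pow,
      Complex.norm_real, Real.norm_of_nonneg hr.le]
    gcongr

theorem evalSeries_derivative_eq_zero {f : ℂ⟦X⟧} (hf : IsEntireSeries f)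
    (h : ∀ x : ℝ, evalSeries x f = 0) (x : ℝ) : evalSeries x (d⁄dX ℂ f) = 0 := by
  have h1 := (hasDerivAt_evalSeries hf (x : ℂ)).comp_ofReal
  simp only [h] at h1
  exact h1.unique (hasDerivAt_const x (0 : ℂ))

theorem evalSeries_at_zero (f : ℂ⟦X⟧) : evalSeries 0 f = coeff 0 f := by
  rw [evalSeries, tsum_eq_single 0 fun n hn => by simp [hn]]
  simp

/-- Evaluation at 0 kills the constant coefficient, and the derivative again vanishes on the real
line. -/
theorem coeff_eq_zero_of_evalSeries_eq_zero (n : ℕ) {f : ℂ⟦X⟧} (hf : IsEntireSeries f)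
    (h : ∀ x : ℝ, evalSeries x f = 0) : coeff n f = 0 := by
  induction n generalizing f with
  | zero => simpa [evalSeries_at_zero] using h 0
  | succ n ih =>
    have := ih hf.derivative (evalSeries_derivative_eq_zero hf h)
    rw [coeff_derivative] at this
    exact (mul_eq_zero.1 this).resolve_right (by exact_mod_cast n.succ_ne_zero)

/-! ### Entire double power series and their derivatives. -/

/-- The coefficients of a double power series that converges everywhere on `ℂ × ℂ`. -/
def IsEntireDouble (α : ℕ × ℕ → ℂ) : Prop :=
  ∀ r : ℝ, 1 ≤ r → ∃ M : ℝ, ∀ k, ‖α k‖ * r ^ (k.1 + k.2) ≤ M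

/-- The sum of a double power series. -/
def evalDouble (α : ℕ × ℕ → ℂ) (z : ℂ × ℂ) : ℂ := ∑' k, α k * z.1 ^ k.1 * z.2 ^ k.2

/-- The coefficients of the derivative in the first variable. -/
def derivFst (α : ℕ × ℕ → ℂ) (k : ℕ × ℕ) : ℂ := ((k.1 : ℂ) + 1) * α (k.1 + 1, k.2)

/-- The coefficients of the derivative in the second variable. -/
def derivSnd (α : ℕ × ℕ → ℂ) (k : ℕ × ℕ) : ℂ := ((k.2 : ℂ) + 1) * α (k.1, k.2 + 1)

theorem IsEntireDouble.add {α β : ℕ × ℕ → ℂ} (hα : IsEntireDouble α) (hβ : IsEntireDouble β) :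
    IsEntireDouble (fun k => α k + β k) := fun r hr => by
  obtain ⟨A, hA⟩ := hα r hr
  obtain ⟨B, hB⟩ := hβ r hr
  refine ⟨A + B, fun k => ?_⟩
  calc ‖α k + β k‖ * r ^ (k.1 + k.2) ≤ (‖α k‖ + ‖β k‖) * r ^ (k.1 + k.2) := by
        gcongr; exact norm_add_le _ _
    _ ≤ A + B := by rw [add_mul]; exact add_le_add (hA k) (hB k)

theorem IsEntireDouble.derivFst {α : ℕ × ℕ → ℂ} (hα : IsEntireDouble α) :
    IsEntireDouble (derivFst α) := fun r hr => by
  obtain ⟨M, hM⟩ := hα (2 * r) (by linarith)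
  refine ⟨M, fun k => le_trans ?_ (hM (k.1 + 1, k.2))⟩
  rw [TimeKernel.derivFst, norm_mul, norm_natCast_add_one, mul_comm _ ‖α _‖, mul_assoc]
  gcongr
  have h1 := succ_le_two_pow k.1
  have h2 : (2 : ℝ) ^ k.1 ≤ 2 ^ (k.1 + 1 + k.2) := pow_le_pow_right₀ (by norm_num) (by omega)
  rw [mul_pow]
  have h3 : r ^ (k.1 + k.2) ≤ r ^ (k.1 + 1 + k.2) := pow_le_pow_right₀ hr (by omega)
  gcongr
  exact h1.trans h2

theorem IsEntireDouble.derivSnd {α : ℕ × ℕ → ℂ} (hα : IsEntireDouble α) :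
    IsEntireDouble (derivSnd α) := fun r hr => by
  obtain ⟨M, hM⟩ := hα (2 * r) (by linarith)
  refine ⟨M, fun k => le_trans ?_ (hM (k.1, k.2 + 1))⟩
  rw [TimeKernel.derivSnd, norm_mul, norm_natCast_add_one, mul_comm _ ‖α _‖, mul_assoc]
  gcongr
  have h1 := succ_le_two_pow k.2
  have h2 : (2 : ℝ) ^ k.2 ≤ 2 ^ (k.1 + (k.2 + 1)) := pow_le_pow_right₀ (by norm_num) (by omega)
  rw [mul_pow]
  have h3 : r ^ (k.1 + k.2) ≤ r ^ (k.1 + (k.2 + 1)) := pow_le_pow_right₀ hr (by omega)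
  gcongr
  exact h1.trans h2

theorem summable_two_inv_pow_add : Summable fun k : ℕ × ℕ => (2⁻¹ : ℝ) ^ (k.1 + k.2) := by
  have h : Summable fun n : ℕ => (2⁻¹ : ℝ) ^ n :=
    summable_geometric_of_lt_one (by norm_num) (by norm_num)
  simpa [pow_add] using h.mul_of_nonneg h (fun _ => by positivity) (fun _ => by positivity)

theorem IsEntireDouble.summable_norm {α : ℕ × ℕ → ℂ} (hα : IsEntireDouble α) {r : ℝ}
    (hr : 1 ≤ r) : Summable fun k : ℕ × ℕ => ‖α k‖ * r ^ (k.1 + k.2) := by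
  obtain ⟨M, hM⟩ := hα (2 * r) (by linarith)
  refine Summable.of_nonneg_of_le (fun _ => by positivity) (fun k => ?_)
    (summable_two_inv_pow_add.mul_left M)
  have := hM k
  rw [mul_pow] at this
  rw [inv_pow, ← div_eq_mul_inv, le_div_iff₀ (by positivity)]
  linarith

theorem norm_term_le (α : ℕ × ℕ → ℂ) {z : ℂ × ℂ} {r : ℝ} (hz : ‖z‖ ≤ r) (k : ℕ × ℕ) :
    ‖α k * z.1 ^ k.1 * z.2 ^ k.2‖ ≤ ‖α k‖ * r ^ (k.1 + k.2) := by
  have h1 := (norm_fst_le z).trans hz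
  have h2 := (norm_snd_le z).trans hz
  have hr := (norm_nonneg z).trans hz
  rw [norm_mul, norm_mul, norm_pow, norm_pow, pow_add, mul_assoc]
  gcongr

theorem IsEntireDouble.summable {α : ℕ × ℕ → ℂ} (hα : IsEntireDouble α) (z : ℂ × ℂ) :
    Summable fun k : ℕ × ℕ => α k * z.1 ^ k.1 * z.2 ^ k.2 :=
  (hα.summable_norm (r := ‖z‖ + 1) (by linarith [norm_nonneg z])).of_norm_bounded
    fun k => norm_term_le α (by linarith) k

theorem evalDouble_add {α β : ℕ × ℕ → ℂ} (hα : IsEntireDouble α) (hβ : IsEntireDouble β)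
    (z : ℂ × ℂ) : evalDouble (fun k => α k + β k) z = evalDouble α z + evalDouble β z := by
  simp only [evalDouble, add_mul]
  exact (hα.summable z).tsum_add (hβ.summable z)

theorem tsum_derivFst (α : ℕ × ℕ → ℂ) (z : ℂ × ℂ) :
    ∑' k : ℕ × ℕ, α k * ((k.1 : ℂ) * z.1 ^ (k.1 - 1)) * z.2 ^ k.2 =
      evalDouble (derivFst α) z := by
  have hi : Function.Injective fun k : ℕ × ℕ => (k.1 + 1, k.2) := by
    rintro ⟨a, b⟩ ⟨c, d⟩ h
    simpa using h
  rw [← hi.tsum_eq]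
  · refine tsum_congr fun k => ?_
    simp only [derivFst, Nat.add_sub_cancel]; push_cast; ring
  · rintro ⟨i, j⟩ hk
    rcases i with _ | i
    · simp at hk
    · exact ⟨(i, j), rfl⟩

theorem tsum_derivSnd (α : ℕ × ℕ → ℂ) (z : ℂ × ℂ) :
    ∑' k : ℕ × ℕ, α k * z.1 ^ k.1 * ((k.2 : ℂ) * z.2 ^ (k.2 - 1)) =
      evalDouble (derivSnd α) z := by
  have hi : Function.Injective fun k : ℕ × ℕ => (k.1, k.2 + 1) := by
    rintro ⟨a, b⟩ ⟨c, d⟩ h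
    simpa using h
  rw [← hi.tsum_eq]
  · refine tsum_congr fun k => ?_
    simp only [derivSnd, Nat.add_sub_cancel]; push_cast; ring
  · rintro ⟨i, j⟩ hk
    rcases j with _ | j
    · simp at hk
    · exact ⟨(i, j), rfl⟩

theorem natCast_mul_pow_pred_le {r : ℝ} (hr : 1 ≤ r) (n : ℕ) :
    (n : ℝ) * r ^ (n - 1) ≤ (2 * r) ^ n := by
  rw [mul_pow]
  have h1 : r ^ (n - 1) ≤ r ^ n := pow_le_pow_right₀ hr (by omega)
  have h2 := succ_le_two_pow n
  gcongr
  linarith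

/-- Termwise differentiation on a ball of radius r; the coefficients at radius 2r majorise both
partial derivatives, as n rⁿ⁻¹ ≤ (2r)ⁿ for r ≥ 1. -/
theorem hasFDerivAt_evalDouble {α : ℕ × ℕ → ℂ} (hα : IsEntireDouble α) (z : ℂ × ℂ) :
    HasFDerivAt (evalDouble α)
      (evalDouble (derivFst α) z • ContinuousLinearMap.fst ℂ ℂ ℂ +
        evalDouble (derivSnd α) z • ContinuousLinearMap.snd ℂ ℂ ℂ) z := by
  set r : ℝ := ‖z‖ + 1
  have hr : 1 ≤ r := by simp [r]
  set A : ℕ × ℕ → ℂ × ℂ → ℂ := fun k z => α k * ((k.1 : ℂ) * z.1 ^ (k.1 - 1)) * z.2 ^ k.2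
  set B : ℕ × ℕ → ℂ × ℂ → ℂ := fun k z => α k * z.1 ^ k.1 * ((k.2 : ℂ) * z.2 ^ (k.2 - 1))
  have hu := hα.summable_norm (r := 2 * r) (by linarith)
  have hA : ∀ k, ∀ y : ℂ × ℂ, ‖y‖ ≤ r → ‖A k y‖ ≤ ‖α k‖ * (2 * r) ^ (k.1 + k.2) := by
    intro k y hy
    have h1 := (norm_fst_le y).trans hy
    have h2 := (norm_snd_le y).trans hy
    simp only [A, norm_mul, norm_pow, Complex.norm_natCast]
    rw [pow_add, mul_assoc]
    have h3 : (k.1 : ℝ) * ‖y.1‖ ^ (k.1 - 1) ≤ (2 * r) ^ k.1 :=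
      le_trans (by gcongr) (natCast_mul_pow_pred_le hr k.1)
    have h4 : ‖y.2‖ ^ k.2 ≤ (2 * r) ^ k.2 := by gcongr; linarith
    gcongr
  have hB : ∀ k, ∀ y : ℂ × ℂ, ‖y‖ ≤ r → ‖B k y‖ ≤ ‖α k‖ * (2 * r) ^ (k.1 + k.2) := by
    intro k y hy
    have h1 := (norm_fst_le y).trans hy
    have h2 := (norm_snd_le y).trans hy
    simp only [B, norm_mul, norm_pow, Complex.norm_natCast]
    rw [pow_add, mul_assoc]
    have h3 : (k.2 : ℝ) * ‖y.2‖ ^ (k.2 - 1) ≤ (2 * r) ^ k.2 :=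
      le_trans (by gcongr) (natCast_mul_pow_pred_le hr k.2)
    have h4 : ‖y.1‖ ^ k.1 ≤ (2 * r) ^ k.1 := by gcongr; linarith
    gcongr
  have key := hasFDerivAt_tsum_of_isPreconnected (𝕜 := ℂ)
    (f := fun k (y : ℂ × ℂ) => α k * y.1 ^ k.1 * y.2 ^ k.2)
    (f' := fun k y => A k y • ContinuousLinearMap.fst ℂ ℂ ℂ +
      B k y • ContinuousLinearMap.snd ℂ ℂ ℂ)
    (hu.add hu) (Metric.isOpen_ball (x := (0 : ℂ × ℂ)) (ε := r))
    (convex_ball _ _).isPreconnected (fun k y _ => ?_) (fun k y hy => ?_)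
    (Metric.mem_ball_self (by linarith)) (hα.summable 0) (x := z) (by simp [r])
  · have hsA : Summable fun k => A k z := hu.of_norm_bounded fun k => hA k z (by simp [r])
    have hsB : Summable fun k => B k z := hu.of_norm_bounded fun k => hB k z (by simp [r])
    rw [(hsA.smul_const _).tsum_add (hsB.smul_const _), hsA.tsum_smul_const, hsB.tsum_smul_const,
      tsum_derivFst, tsum_derivSnd] at key
    exact key
  · have h1 : HasFDerivAt (fun y : ℂ × ℂ => y.1 ^ k.1) _ y := (hasFDerivAt_fst (𝕜 := ℂ)).pow k.1
    have h2 : HasFDerivAt (fun y : ℂ × ℂ => y.2 ^ k.2) _ y := (hasFDerivAt_snd (𝕜 := ℂ)).pow k.2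
    refine ((h1.const_mul (α k)).mul h2).congr_fderiv ?_
    ext
    · simp [A, B]; ring
    · simp [A, B]
  · have hy' : ‖y‖ ≤ r := by simpa using (Metric.mem_ball.1 hy).le
    refine (norm_add_le _ _).trans (add_le_add ?_ ?_)
    · rw [norm_smul]
      exact (mul_le_of_le_one_right (norm_nonneg _) (ContinuousLinearMap.norm_fst_le ..)).trans
        (hA k y hy')
    · rw [norm_smul]
      exact (mul_le_of_le_one_right (norm_nonneg _) (ContinuousLinearMap.norm_snd_le ..)).trans
        (hB k y hy')

theorem contDiff_evalDouble (n : ℕ) {α : ℕ × ℕ → ℂ} (hα : IsEntireDouble α) :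
    ContDiff ℂ n (evalDouble α) := by
  induction n generalizing α with
  | zero =>
    exact contDiff_zero.2 (continuous_iff_continuousAt.2 fun z =>
      (hasFDerivAt_evalDouble hα z).continuousAt)
  | succ n ih =>
    push_cast
    refine contDiff_succ_iff_hasFDerivAt.2 ⟨_, ?_, hasFDerivAt_evalDouble hα⟩
    exact ((ih hα.derivFst).smul contDiff_const).add ((ih hα.derivSnd).smul contDiff_const)

/-! ### Double series sorted by rows, and their products. -/

/-- The coefficients of the double series `∑ aₙ(x) yⁿ`. -/
def rows (a : ℕ → ℂ⟦X⟧) (k : ℕ × ℕ) : ℂ := coeff k.1 (a k.2)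

theorem hasSum_rows {a : ℕ → ℂ⟦X⟧} (ha : IsEntireDouble (rows a)) (x y : ℂ) :
    HasSum (fun n => evalSeries x (a n) * y ^ n) (evalDouble (rows a) (x, y)) := by
  have h := (Equiv.prodComm ℕ ℕ).hasSum_iff.2 (ha.summable (x, y)).hasSum
  have hs : ∀ n, Summable fun m => coeff m (a n) * x ^ m * y ^ n := fun n =>
    h.summable.prod_factor n
  refine HasSum.prod_fiberwise h fun n => ?_
  have := (hs n).hasSum
  rwa [tsum_mul_right] at this

theorem isEntireSeries_of_rows {a : ℕ → ℂ⟦X⟧} (ha : IsEntireDouble (rows a)) (n : ℕ) :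
    IsEntireSeries (a n) := fun x => by
  have h := (Equiv.prodComm ℕ ℕ).summable_iff.2 (ha.summable (x, 1))
  simpa [rows] using h.prod_factor n

/-- The rows of the product of the double series with the rows `a` and `b`. -/
def rowProduct (a b : ℕ → ℂ⟦X⟧) (n : ℕ) : ℂ⟦X⟧ := ∑ p ∈ antidiagonal n, a p.1 * b p.2

theorem evalSeries_rowProduct {a b : ℕ → ℂ⟦X⟧} (ha : ∀ n, IsEntireSeries (a n))
    (hb : ∀ n, IsEntireSeries (b n)) (x : ℂ) (n : ℕ) :
    evalSeries x (rowProduct a b n) =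
      ∑ p ∈ antidiagonal n, evalSeries x (a p.1) * evalSeries x (b p.2) := by
  have h : evalSeries x (rowProduct a b n) =
      ∑ p ∈ antidiagonal n, evalSeries x (a p.1 * b p.2) := by
    apply evalSeries_sum
    intro p _
    exact (ha p.1).mul (hb p.2)
  rw [h]
  refine Finset.sum_congr rfl fun p _ => ?_
  rw [evalSeries_mul (ha p.1) (hb p.2)]

/-- Cauchy product in y with rows as coefficients. Convergence of the product is assumed here; where
it is applied, the differential equation itself provides it. -/
theorem evalDouble_mul {a b : ℕ → ℂ⟦X⟧} (ha : IsEntireDouble (rows a))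
    (hb : IsEntireDouble (rows b))
    (hab : IsEntireDouble (rows (rowProduct a b))) (z : ℂ × ℂ) :
    evalDouble (rows (rowProduct a b)) z =
      evalDouble (rows a) z * evalDouble (rows b) z := by
  obtain ⟨x, y⟩ := z
  have h1 := hasSum_rows ha x y
  have h2 := hasSum_rows hb x y
  have he := isEntireSeries_of_rows ha
  have hf := isEntireSeries_of_rows hb
  have h3 := tsum_mul_tsum_eq_tsum_sum_antidiagonal_of_summable_norm h1.summable.norm
    h2.summable.norm
  rw [h1.tsum_eq, h2.tsum_eq] at h3
  refine ((hasSum_rows hab x y).tsum_eq.symm.trans (tsum_congr fun n => ?_)).trans h3.symm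
  rw [evalSeries_rowProduct he hf, Finset.sum_mul]
  refine Finset.sum_congr rfl fun p hp => ?_
  have e : p.1 + p.2 = n := mem_antidiagonal.1 hp
  rw [← e, pow_add, mul_mul_mul_comm]

/-! ### Convergence of power series solutions of the Goursat problem. -/

/-- The rows `aₙ` of a double series `F(x,y) = ∑ aₙ(x) yⁿ` satisfy the recursion that expresses
the equation `∂²F/∂x∂y = Λ w F`, where `w` is the double series with the rows `w`. -/
def IsGoursatSeries (Λ : ℂ) (w a : ℕ → ℂ⟦X⟧) : Prop :=
  ∀ n : ℕ, ((n : ℂ) + 1) • d⁄dX ℂ (a (n + 1)) = Λ • rowProduct w a n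

theorem coeff_rowProduct (a b : ℕ → ℂ⟦X⟧) (m n : ℕ) :
    coeff m (rowProduct a b n) = ∑ p ∈ antidiagonal n, ∑ q ∈ antidiagonal m,
      rows a (q.1, p.1) * rows b (q.2, p.2) := by
  rw [rowProduct, map_sum]
  refine Finset.sum_congr rfl fun p _ => ?_
  rw [coeff_mul]
  rfl

theorem IsGoursatSeries.coeff_eq {Λ : ℂ} {w a : ℕ → ℂ⟦X⟧} (h : IsGoursatSeries Λ w a) (m n : ℕ) :
    ((n : ℂ) + 1) * (((m : ℂ) + 1) * rows a (m + 1, n + 1)) = Λ * coeff m (rowProduct w a n) := by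
  have := congrArg (coeff m) (h n)
  simp only [map_smul, smul_eq_mul, coeff_derivative] at this
  rw [← this, rows]
  ring

theorem sum_antidiagonal_two_inv_pow_le (n : ℕ) :
    ∑ p ∈ antidiagonal n, (2⁻¹ : ℝ) ^ p.1 ≤ 2 := by
  rw [Finset.Nat.sum_antidiagonal_eq_sum_range_succ_mk]
  have h : Summable fun n : ℕ => (2⁻¹ : ℝ) ^ n :=
    summable_geometric_of_lt_one (by norm_num) (by norm_num)
  refine (h.sum_le_tsum _ fun _ _ => by positivity).trans ?_
  rw [tsum_geometric_of_lt_one (by norm_num) (by norm_num)]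
  norm_num

/-- For fixed r a single bound M propagates by induction on the row. Bounding the coefficients of w
at radius 2r turns the convolution into two geometric sums, so it is at most 4CM. The recursion
divides by (m+1)(n+1), which beats the constant L outside a finite square of indices. -/
theorem IsGoursatSeries.isEntireDouble {Λ : ℂ} {w a : ℕ → ℂ⟦X⟧} (h : IsGoursatSeries Λ w a)
    (hw : IsEntireDouble (rows w)) (h0 : IsEntireSeries (a 0))
    (hg : ∀ r : ℝ, 1 ≤ r → ∃ M : ℝ, ∀ n, ‖rows a (0, n)‖ * r ^ n ≤ M) :
    IsEntireDouble (rows a) := by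
  intro r hr
  have hr0 : 0 < r := by linarith
  obtain ⟨C, hC⟩ := hw (2 * r) (by linarith)
  obtain ⟨M1, hM1⟩ := hg r hr
  have hC0 : 0 ≤ C := le_trans (by positivity) (hC 0)
  have hM10 : 0 ≤ M1 := le_trans (by positivity) (hM1 0)
  have hs := (h0 r).norm
  set M2 : ℝ := ∑' n, ‖coeff n (a 0) * (r : ℂ) ^ n‖
  have hM2 : ∀ m, ‖rows a (m, 0)‖ * r ^ m ≤ M2 := fun m => by
    have := hs.le_tsum m fun _ _ => norm_nonneg _
    simpa [rows, abs_of_pos hr0, M2] using this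
  have hM20 : 0 ≤ M2 := le_trans (by positivity) (hM2 0)
  -- The 4 comes from the two geometric sums of ratio 1/2, and r² from raising both indices by one.
  set L : ℝ := ‖Λ‖ * C * 4 * r ^ 2
  obtain ⟨K, hK⟩ := exists_nat_ge L
  set S := Finset.range K ×ˢ Finset.range K
  -- The finitely many indices at which the recursion does not yet contract are put into the bound
  -- by hand.
  set M3 : ℝ := ∑ k ∈ S, ‖rows a (k.1 + 1, k.2 + 1)‖ * r ^ (k.1 + 1 + (k.2 + 1))
  have hM30 : 0 ≤ M3 := Finset.sum_nonneg fun _ _ => by positivity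
  set M := M1 + M2 + M3
  have hM0 : 0 ≤ M := by positivity
  refine ⟨M, ?_⟩
  suffices H : ∀ n m, ‖rows a (m, n)‖ * r ^ (m + n) ≤ M from fun k => H k.2 k.1
  intro n
  induction n using Nat.strong_induction_on with
  | _ n ih =>
  intro m
  rcases n with _ | n
  · have := hM2 m
    simp only [add_zero]; linarith
  rcases m with _ | m
  · have := hM1 (n + 1)
    simp only [zero_add]; linarith
  by_cases hmn : m < K ∧ n < K
  · have : ‖rows a (m + 1, n + 1)‖ * r ^ (m + 1 + (n + 1)) ≤ M3 :=
      Finset.single_le_sum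
        (f := fun k : ℕ × ℕ => ‖rows a (k.1 + 1, k.2 + 1)‖ * r ^ (k.1 + 1 + (k.2 + 1)))
        (fun _ _ => by positivity) (a := (m, n)) (by simp [S, hmn])
    linarith
  have hL : L ≤ ((n : ℝ) + 1) * (m + 1) := by
    have hn : (0 : ℝ) ≤ n := n.cast_nonneg
    have hm : (0 : ℝ) ≤ m := m.cast_nonneg
    have : (K : ℝ) ≤ m ∨ (K : ℝ) ≤ n := by
      by_contra! hc
      exact hmn ⟨by exact_mod_cast hc.1, by exact_mod_cast hc.2⟩
    rcases this with h1 | h1 <;> nlinarith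
  have hterm : ‖coeff m (rowProduct w a n)‖ * r ^ (m + n) ≤ C * M * 4 := by
    rw [coeff_rowProduct]
    calc _ ≤ (∑ p ∈ antidiagonal n, ∑ q ∈ antidiagonal m,
          ‖rows w (q.1, p.1) * rows a (q.2, p.2)‖) * r ^ (m + n) := by
          gcongr
          exact (norm_sum_le _ _).trans (Finset.sum_le_sum fun p _ => norm_sum_le _ _)
      _ ≤ ∑ p ∈ antidiagonal n, ∑ q ∈ antidiagonal m,
          C * M * ((2⁻¹ : ℝ) ^ p.1 * (2⁻¹ : ℝ) ^ q.1) := by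
          simp only [Finset.sum_mul]
          refine Finset.sum_le_sum fun p hp => Finset.sum_le_sum fun q hq => ?_
          have ep : p.1 + p.2 = n := mem_antidiagonal.1 hp
          have eq : q.1 + q.2 = m := mem_antidiagonal.1 hq
          have h1 := hC (q.1, p.1)
          have h2 := ih p.2 (by omega) q.2
          simp only at h1 h2
          have h3 : ‖rows w (q.1, p.1)‖ * r ^ (q.1 + p.1) ≤
              C * ((2⁻¹ : ℝ) ^ p.1 * (2⁻¹ : ℝ) ^ q.1) := by
            rw [mul_pow] at h1
            rw [← pow_add, inv_pow, ← div_eq_mul_inv, le_div_iff₀ (by positivity), add_comm p.1]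
            linarith
          calc ‖rows w (q.1, p.1) * rows a (q.2, p.2)‖ * r ^ (m + n)
              = (‖rows w (q.1, p.1)‖ * r ^ (q.1 + p.1)) *
                  (‖rows a (q.2, p.2)‖ * r ^ (q.2 + p.2)) := by
                rw [norm_mul, ← ep, ← eq]; ring
            _ ≤ (C * ((2⁻¹ : ℝ) ^ p.1 * (2⁻¹ : ℝ) ^ q.1)) * M := by gcongr
            _ = _ := by ring
      _ = C * M * ((∑ p ∈ antidiagonal n, (2⁻¹ : ℝ) ^ p.1) *
            ∑ q ∈ antidiagonal m, (2⁻¹ : ℝ) ^ q.1) := by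
          simp only [← Finset.mul_sum, Finset.sum_mul]
      _ ≤ C * M * (2 * 2) := by
          have h1 := sum_antidiagonal_two_inv_pow_le n
          have h2 := sum_antidiagonal_two_inv_pow_le m
          gcongr
      _ = _ := by ring
  have hco := congrArg norm (h.coeff_eq m n)
  rw [norm_mul, norm_mul, norm_mul, norm_natCast_add_one, norm_natCast_add_one] at hco
  have hmain : ((n : ℝ) + 1) * (m + 1) * (‖rows a (m + 1, n + 1)‖ * r ^ (m + 1 + (n + 1))) ≤
      L * M := by
    calc _ = (‖Λ‖ * ‖coeff m (rowProduct w a n)‖) * (r ^ (m + n) * r ^ 2) := by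
          rw [← hco]; ring
      _ = ‖Λ‖ * r ^ 2 * (‖coeff m (rowProduct w a n)‖ * r ^ (m + n)) := by ring
      _ ≤ ‖Λ‖ * r ^ 2 * (C * M * 4) := by gcongr
      _ = L * M := by simp only [L]; ring
  have hpos : (0 : ℝ) < ((n : ℝ) + 1) * (m + 1) := by positivity
  refine le_of_mul_le_mul_left (hmain.trans ?_) hpos
  gcongr

/-! ### The potential difference as a double series. -/

/-- The rows of the double series of `(U(x + y) - U(x - y)) / 2`. -/
def oddPart (U : ℂ⟦X⟧) (j : ℕ) : ℂ⟦X⟧ :=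
  PowerSeries.mk fun i => if Odd j then coeff (i + j) U * ((i + j).choose j : ℂ) else 0

theorem isEntireDouble_oddPart {U : ℂ⟦X⟧} (hU : IsEntireSeries U) :
    IsEntireDouble (rows (oddPart U)) := by
  intro r hr
  have hr0 : 0 < r := by linarith
  have hs := (hU ((2 * r : ℝ) : ℂ)).norm
  refine ⟨∑' n, ‖coeff n U * ((2 * r : ℝ) : ℂ) ^ n‖, fun k => ?_⟩
  refine le_trans ?_ (hs.le_tsum (k.1 + k.2) fun _ _ => norm_nonneg _)
  rw [norm_mul, norm_pow, Complex.norm_real, Real.norm_of_nonneg (by positivity), mul_pow,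
    ← mul_assoc]
  gcongr
  simp only [rows, oddPart, coeff_mk]
  split_ifs
  · rw [norm_mul, Complex.norm_natCast]
    gcongr
    exact_mod_cast Nat.choose_le_two_pow _ _
  · simp only [norm_zero]; positivity

/-- Summed along the diagonals i + j = n, this is the binomial expansion of (x ± y)ⁿ, in which the
even powers of y cancel. -/
theorem evalDouble_oddPart {U : ℂ⟦X⟧} (hU : IsEntireSeries U) (x y : ℂ) :
    evalDouble (rows (oddPart U)) (x, y) =
      (evalSeries (x + y) U - evalSeries (x - y) U) / 2 := by
  have h := (isEntireDouble_oddPart hU).summable (x, y)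
  have h1 := Finset.HasAntidiagonal.sigmaAntidiagonalEquivProd.hasSum_iff.2 h.hasSum
  have h2 := h1.sigma fun n => hasSum_fintype _
  refine h2.unique ?_
  have h3 := ((hU.hasSum (x + y)).sub (hU.hasSum (x - y))).div_const 2
  refine (congrArg (HasSum · _) (funext fun n => ?_)).mpr h3
  rw [Finset.univ_eq_attach]
  change ∑ p ∈ (antidiagonal n).attach,
    rows (oddPart U) p.1 * x ^ p.1.1 * y ^ p.1.2 = _
  rw [Finset.sum_attach (antidiagonal n)
    (fun p => rows (oddPart U) p * x ^ p.1 * y ^ p.2), sub_eq_add_neg x y,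
    (Commute.all x y).add_pow', (Commute.all x (-y)).add_pow', ← mul_sub, ← Finset.sum_sub_distrib,
    mul_div_assoc, Finset.sum_div, Finset.mul_sum]
  refine Finset.sum_congr rfl fun p hp => ?_
  obtain ⟨i, j⟩ := p
  have e : i + j = n := mem_antidiagonal.1 hp
  have ec : n.choose i = n.choose j := Nat.choose_symm_of_eq_add e.symm
  simp only [rows, oddPart, coeff_mk, e, ec, nsmul_eq_mul]
  split_ifs with hj
  · rw [hj.neg_pow]; ring
  · rw [(Nat.not_odd_iff_even.1 hj).neg_pow]; ring

/-! ### Uniqueness for the Goursat problem and the time kernel equation. -/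

/-- Let M be the maximum of |G| e^(-c(u+v)) on the square. Integrating the bound on the mixed
derivative in u and in v gains a factor 1/c each time, so M ≤ (L/c²) M. With c = L + 1 this forces M
= 0. -/
theorem eq_zero_of_goursat {G Gv Guv : ℝ → ℝ → ℂ} {R L : ℝ} (hR : 0 ≤ R) (hL : 0 ≤ L)
    (hc : Continuous fun z : ℝ × ℝ => G z.1 z.2)
    (hv : ∀ u v, HasDerivAt (G u) (Gv u v) v)
    (huv : ∀ u v, HasDerivAt (fun u => Gv u v) (Guv u v) u)
    (hb : ∀ u ∈ Set.Icc 0 R, ∀ v ∈ Set.Icc 0 R, ‖Guv u v‖ ≤ L * ‖G u v‖)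
    (h0 : ∀ u, G u 0 = 0) (h1 : ∀ v, Gv 0 v = 0) :
    ∀ u ∈ Set.Icc 0 R, ∀ v ∈ Set.Icc 0 R, G u v = 0 := by
  set c : ℝ := L + 1
  have hc0 : 0 < c := by positivity
  have hLc : L < c * c := by simp only [c]; nlinarith
  have h0R : (0 : ℝ) ∈ Set.Icc 0 R := ⟨le_rfl, hR⟩
  obtain ⟨z, hz, hmax⟩ := (isCompact_Icc.prod isCompact_Icc :
    IsCompact (Set.Icc (0 : ℝ) R ×ˢ Set.Icc (0 : ℝ) R)).exists_isMaxOn ⟨(0, 0), h0R, h0R⟩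
    (f := fun z : ℝ × ℝ => ‖G z.1 z.2‖ * Real.exp (-(c * (z.1 + z.2))))
    (by fun_prop)
  set M := ‖G z.1 z.2‖ * Real.exp (-(c * (z.1 + z.2))) with hM
  have hM0 : 0 ≤ M := by positivity
  have hG : ∀ u ∈ Set.Icc 0 R, ∀ v ∈ Set.Icc 0 R, ‖G u v‖ ≤ M * Real.exp (c * (u + v)) := by
    intro u hu v hv
    have h : ‖G u v‖ * Real.exp (-(c * (u + v))) ≤ M := hmax (Set.mk_mem_prod hu hv)
    rwa [Real.exp_neg, ← div_eq_mul_inv, div_le_iff₀ (Real.exp_pos _)] at h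
  have hexp : ∀ A w s : ℝ, HasDerivAt (fun s => A * Real.exp (c * (w + s)))
      (A * c * Real.exp (c * (w + s))) s := fun A w s => by
    have := (((hasDerivAt_id s).const_add w).const_mul c).exp.const_mul A
    refine this.congr_deriv ?_
    simp only [id]; ring
  have hGv : ∀ u ∈ Set.Icc 0 R, ∀ v ∈ Set.Icc 0 R,
      ‖Gv u v‖ ≤ L * M / c * Real.exp (c * (v + u)) := by
    intro u hu v hv
    refine image_norm_le_of_norm_deriv_right_le_deriv_boundary (f := fun u => Gv u v)
      (fun s _ => (huv s v).continuousAt.continuousWithinAt)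
      (fun s _ => (huv s v).hasDerivWithinAt) ?_ (hexp _ v) (fun s hs => ?_) hu
    · rw [h1, norm_zero]; positivity
    · have hs' := Set.Ico_subset_Icc_self hs
      refine (hb s hs' v hv).trans ?_
      rw [div_mul_cancel₀ _ hc0.ne', mul_assoc, add_comm v]
      gcongr
      exact hG s hs' v hv
  have hG2 : ∀ u ∈ Set.Icc 0 R, ∀ v ∈ Set.Icc 0 R,
      ‖G u v‖ ≤ L * M / c / c * Real.exp (c * (u + v)) := by
    intro u hu v hv'
    refine image_norm_le_of_norm_deriv_right_le_deriv_boundary (f := G u)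
      (fun s _ => (hv u s).continuousAt.continuousWithinAt)
      (fun s _ => (hv u s).hasDerivWithinAt) ?_ (hexp _ u) (fun s hs => ?_) hv'
    · rw [h0, norm_zero]; positivity
    · refine (hGv u hu s (Set.Ico_subset_Icc_self hs)).trans (le_of_eq ?_)
      rw [div_mul_cancel₀ _ hc0.ne', add_comm u]
  have hMle : M ≤ L * M / c / c := by
    have := hG2 z.1 hz.1 z.2 hz.2
    rwa [← div_le_iff₀ (Real.exp_pos _), div_eq_mul_inv, ← Real.exp_neg, ← hM] at this
  have hM00 : M = 0 := by
    rw [div_div, le_div_iff₀ (by positivity)] at hMle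
    nlinarith
  intro u hu v hv
  have := hG u hu v hv
  rw [hM00, zero_mul] at this
  exact norm_le_zero_iff.1 this

theorem iteratedDeriv_two_eq {f f' : ℝ → ℂ} {c : ℂ} {x : ℝ} (h : ∀ s, HasDerivAt f (f' s) s)
    (h' : HasDerivAt f' c x) : iteratedDeriv 2 f x = c := by
  rw [show (2 : ℕ) = 1 + 1 from rfl, iteratedDeriv_succ, iteratedDeriv_one,
    funext fun s => (h s).deriv, h'.deriv]

theorem hasDerivAt_line {f : ℝ × ℝ → ℂ} (hf : ContDiff ℝ 2 f) (p b : ℝ × ℝ) (s : ℝ) :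
    HasDerivAt (fun s : ℝ => f (p + s • b)) (fderiv ℝ f (p + s • b) b) s := by
  have h1 : HasDerivAt (fun s : ℝ => p + s • b) b s := by
    simpa using ((hasDerivAt_id s).smul_const b).const_add p
  exact ((hf.differentiable (by norm_num)) _).hasFDerivAt.comp_hasDerivAt s h1

theorem hasDerivAt_fderiv_line {f : ℝ × ℝ → ℂ} (hf : ContDiff ℝ 2 f) (p a b : ℝ × ℝ) (s : ℝ) :
    HasDerivAt (fun s : ℝ => fderiv ℝ f (p + s • a) b)
      (fderiv ℝ (fderiv ℝ f) (p + s • a) a b) s := by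
  have h1 : HasDerivAt (fun s : ℝ => p + s • a) a s := by
    simpa using ((hasDerivAt_id s).smul_const a).const_add p
  have h2 : ContDiff ℝ 1 (fderiv ℝ f) := hf.fderiv_right (by norm_num)
  have h3 := ((h2.differentiable (by norm_num)) (p + s • a)).hasFDerivAt.comp_hasDerivAt s h1
  exact h3.clm_apply (hasDerivAt_const s b) |>.congr_deriv (by simp)

theorem iteratedDeriv_two_line {f : ℝ × ℝ → ℂ} (hf : ContDiff ℝ 2 f) (p a : ℝ × ℝ) (s : ℝ) :
    iteratedDeriv 2 (fun s : ℝ => f (p + s • a)) s =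
      fderiv ℝ (fderiv ℝ f) (p + s • a) a a :=
  iteratedDeriv_two_eq (hasDerivAt_line hf p a) (hasDerivAt_fderiv_line hf p a a s)

/-- Along the directions (1,1) and (1,-1) the difference of the pure second derivatives is a mixed
derivative, by symmetry of the second derivative, so the Goursat estimate applies. -/
theorem eq_zero_of_isTimeKernelSolution {ħ μ : ℝ} (hħ : 0 < ħ) (hμ : 0 < μ) {V : ℝ → ℝ}
    (hV : Continuous V) {T : ℝ → ℝ → ℂ}
    (hT : IsTimeKernelSolution ħ μ V (fun _ => 0) (fun _ => 0) T) (x y : ℝ) : T x y = 0 := by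
  set f : ℝ × ℝ → ℂ := fun z => T z.1 z.2
  have hf : ContDiff ℝ 2 f := hT.contDiff
  have hsecond : ∀ z : ℝ × ℝ, fderiv ℝ (fderiv ℝ f) z (1, 1) (1, -1) =
      2 * μ / ħ ^ 2 * (V z.1 - V z.2) * f z := by
    rintro ⟨x, y⟩
    have hx : iteratedDeriv 2 (fun s => T s y) x =
        fderiv ℝ (fderiv ℝ f) (x, y) (1, 0) (1, 0) := by
      simpa [f] using iteratedDeriv_two_line hf (0, y) (1, 0) x
    have hy : iteratedDeriv 2 (fun s => T x s) y =
        fderiv ℝ (fderiv ℝ f) (x, y) (0, 1) (0, 1) := by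
      simpa [f] using iteratedDeriv_two_line hf (x, 0) (0, 1) y
    have hsymm := (hf.contDiffAt (x := (x, y))).isSymmSndFDerivAt (by simp)
    have heq := hT.equation x y
    rw [hx, hy] at heq
    have e1 : ((1, 1) : ℝ × ℝ) = (1, 0) + (0, 1) := by simp
    have e2 : ((1, -1) : ℝ × ℝ) = (1, 0) - (0, 1) := by simp
    rw [e1, e2, map_add, add_apply, map_sub, map_sub,
      hsymm.eq (0, 1) (1, 0)]
    have hħ' : (ħ : ℂ) ≠ 0 := by exact_mod_cast hħ.ne'
    have hμ' : (μ : ℂ) ≠ 0 := by exact_mod_cast hμ.ne'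
    simp only [f]
    field_simp
    field_simp at heq
    linear_combination (-1 : ℂ) * heq
  -- The signs s and t reflect the quadrant containing (x+y, x-y) onto the positive one, so that one
  -- square [0,R]² serves all points.
  obtain ⟨s, hs, hsu⟩ : ∃ s : ℝ, |s| = 1 ∧ s * |x + y| = x + y := by
    rcases abs_cases (x + y) with h | h
    · exact ⟨1, by simp, by rw [h.1]; ring⟩
    · exact ⟨-1, by simp, by rw [h.1]; ring⟩
  obtain ⟨t, ht, htv⟩ : ∃ t : ℝ, |t| = 1 ∧ t * |x - y| = x - y := by
    rcases abs_cases (x - y) with h | h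
    · exact ⟨1, by simp, by rw [h.1]; ring⟩
    · exact ⟨-1, by simp, by rw [h.1]; ring⟩
  set R := max |x + y| |x - y|
  set a : ℝ × ℝ := (s / 2) • (1, 1) with ha
  set b : ℝ × ℝ := (t / 2) • (1, -1) with hb
  obtain ⟨L, hL⟩ := (isCompact_Icc.prod isCompact_Icc :
    IsCompact (Set.Icc (0 : ℝ) R ×ˢ Set.Icc (0 : ℝ) R)).exists_bound_of_continuousOn
    (f := fun z : ℝ × ℝ => s / 2 * (t / 2) * (2 * μ / ħ ^ 2 *
      (V (z.1 • a + z.2 • b).1 - V (z.1 • a + z.2 • b).2))) (by fun_prop)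
  have hR : 0 ≤ R := le_max_of_le_left (abs_nonneg _)
  have hL0 : 0 ≤ L := (norm_nonneg _).trans (hL (0, 0) ⟨⟨le_rfl, hR⟩, ⟨le_rfl, hR⟩⟩)
  have hab : ∀ z, fderiv ℝ (fderiv ℝ f) z a b =
      ((s / 2 * (t / 2) * (2 * μ / ħ ^ 2 * (V z.1 - V z.2)) : ℝ) : ℂ) * f z := by
    intro z
    rw [ha, hb, map_smul, map_smul, smul_apply, hsecond, smul_smul,
      Complex.real_smul]
    push_cast; ring
  have key := eq_zero_of_goursat (G := fun u v => f (u • a + v • b))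
    (Gv := fun u v => fderiv ℝ f (u • a + v • b) b)
    (Guv := fun u v => fderiv ℝ (fderiv ℝ f) (u • a + v • b) a b) hR hL0
    (hf.continuous.comp (by fun_prop)) (fun u v => hasDerivAt_line hf (u • a) b v)
    (fun u v => ?_) (fun u hu v hv => ?_) (fun u => ?_) (fun v => ?_)
    |x + y| ⟨abs_nonneg _, le_max_left _ _⟩ |x - y| ⟨abs_nonneg _, le_max_right _ _⟩
  · have e : |x + y| • a + |x - y| • b = (x, y) := by
      ext
      · simp [a, b]; linear_combination hsu / 2 + htv / 2
      · simp [a, b]; linear_combination hsu / 2 - htv / 2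
    simpa only [e] using key
  · have := hasDerivAt_fderiv_line hf (v • b) a b u
    simpa only [add_comm (v • b)] using this
  · simp only [hab, norm_mul]
    gcongr
    have := hL (u, v) ⟨hu, hv⟩
    rwa [Complex.norm_real]
  · have := hT.diag (u * (s / 2))
    simpa [f, a] using this
  -- The function is zero along the whole antidiagonal, hence so is its derivative in that
  -- direction.
  · have h1 := hasDerivAt_line hf 0 b v
    have h2 : (fun v : ℝ => f (0 + v • b)) = fun _ => 0 := by
      funext v
      have := hT.antidiag (v * (t / 2))
      simpa [f, b] using this
    rw [h2] at h1
    simpa using h1.unique (hasDerivAt_const v (0 : ℂ))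

theorem isTimeKernelSolution_add {ħ μ : ℝ} {V : ℝ → ℝ} {f g f' g' : ℝ → ℂ} {T S : ℝ → ℝ → ℂ}
    (hT : IsTimeKernelSolution ħ μ V f g T) (hS : IsTimeKernelSolution ħ μ V f' g' S) (c : ℂ) :
    IsTimeKernelSolution ħ μ V (fun x => f x + c * f' x) (fun x => g x + c * g' x)
      (fun x y => T x y + c * S x y) where
  contDiff := hT.contDiff.add (contDiff_const.mul hS.contDiff)
  diag x := by rw [hT.diag, hS.diag]
  antidiag x := by rw [hT.antidiag, hS.antidiag]
  equation x y := by
    have h1 : ∀ {T : ℝ → ℝ → ℂ}, ContDiff ℝ 2 (fun z : ℝ × ℝ => T z.1 z.2) →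
        ContDiffAt ℝ (2 : ℕ) (fun s => T s y) x := fun {T : ℝ → ℝ → ℂ} h =>
      (h.comp (contDiff_id.prodMk contDiff_const)).contDiffAt
    have h2 : ∀ {T : ℝ → ℝ → ℂ}, ContDiff ℝ 2 (fun z : ℝ × ℝ => T z.1 z.2) →
        ContDiffAt ℝ (2 : ℕ) (fun s => T x s) y := fun {T : ℝ → ℝ → ℂ} h =>
      (h.comp (contDiff_const.prodMk contDiff_id)).contDiffAt
    have e1 := iteratedDeriv_add (h1 hT.contDiff) (contDiffAt_const (c := c) |>.mul (h1 hS.contDiff))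
    have e2 := iteratedDeriv_add (h2 hT.contDiff) (contDiffAt_const (c := c) |>.mul (h2 hS.contDiff))
    have e3 := iteratedDeriv_const_mul c (h1 hS.contDiff)
    have e4 := iteratedDeriv_const_mul c (h2 hS.contDiff)
    simp only [Pi.add_def] at e1 e2
    rw [e1, e2, e3, e4]
    linear_combination hT.equation x y + c * hS.equation x y

theorem isTheTimeKernelSolution {ħ μ : ℝ} (hħ : 0 < ħ) (hμ : 0 < μ) {V : ℝ → ℝ}
    (hV : Continuous V) {f g : ℝ → ℂ} {T : ℝ → ℝ → ℂ} (hT : IsTimeKernelSolution ħ μ V f g T) :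
    IsTheTimeKernelSolution ħ μ V f g T := by
  refine ⟨hT, fun S hS => ?_⟩
  have h := isTimeKernelSolution_add hS hT (-1)
  simp only [neg_one_mul, add_neg_cancel] at h
  funext x y
  have := eq_zero_of_isTimeKernelSolution hħ hμ hV h x y
  linear_combination this

/-! ### From Goursat series to solutions of the time kernel equation. -/

/-- The kernel factor with the double series `α` in the variables `x + y`, `x - y`. -/
def kernelFactor (α : ℕ × ℕ → ℂ) (x y : ℝ) : ℂ :=
  evalDouble α (((x + y : ℝ) : ℂ), ((x - y : ℝ) : ℂ))

theorem contDiff_kernelFactor {α : ℕ × ℕ → ℂ} (hα : IsEntireDouble α) :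
    ContDiff ℝ 2 (fun z : ℝ × ℝ => kernelFactor α z.1 z.2) := by
  have h : ContDiff ℝ 2 (evalDouble α) := (contDiff_evalDouble 2 hα).restrict_scalars ℝ
  exact h.comp ((Complex.ofRealCLM.contDiff.comp (contDiff_fst.add contDiff_snd)).prodMk
    (Complex.ofRealCLM.contDiff.comp (contDiff_fst.sub contDiff_snd)))

theorem hasDerivAt_kernelFactor_left {α : ℕ × ℕ → ℂ} (hα : IsEntireDouble α) (x y : ℝ) :
    HasDerivAt (fun s => kernelFactor α s y)
      (kernelFactor (derivFst α) x y + kernelFactor (derivSnd α) x y) x := by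
  have h1 : HasDerivAt (fun s : ℂ => (s + y, s - y)) ((1 : ℂ), (1 : ℂ)) (x : ℂ) :=
    ((hasDerivAt_id _).add_const _).prodMk ((hasDerivAt_id _).sub_const _)
  have h2 := ((hasFDerivAt_evalDouble hα _).comp_hasDerivAt (x : ℂ) h1).comp_ofReal
  simpa [kernelFactor, Function.comp_def] using h2

theorem hasDerivAt_kernelFactor_right {α : ℕ × ℕ → ℂ} (hα : IsEntireDouble α) (x y : ℝ) :
    HasDerivAt (fun s => kernelFactor α x s)
      (kernelFactor (derivFst α) x y - kernelFactor (derivSnd α) x y) y := by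
  have h1 : HasDerivAt (fun s : ℂ => (x + s, x - s)) ((1 : ℂ), (-1 : ℂ)) (y : ℂ) :=
    ((hasDerivAt_id _).const_add _).prodMk ((hasDerivAt_id _).const_sub _)
  have h2 := ((hasFDerivAt_evalDouble hα _).comp_hasDerivAt (y : ℂ) h1).comp_ofReal
  simpa [kernelFactor, Function.comp_def, sub_eq_add_neg] using h2

theorem derivSnd_derivFst (α : ℕ × ℕ → ℂ) : derivSnd (derivFst α) = derivFst (derivSnd α) := by
  funext k
  simp only [derivSnd, derivFst]
  ring

theorem iteratedDeriv_kernelFactor_sub {α : ℕ × ℕ → ℂ} (hα : IsEntireDouble α) (x y : ℝ) :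
    iteratedDeriv 2 (fun s => kernelFactor α s y) x -
      iteratedDeriv 2 (fun s => kernelFactor α x s) y =
      4 * kernelFactor (derivFst (derivSnd α)) x y := by
  rw [iteratedDeriv_two_eq (fun s => hasDerivAt_kernelFactor_left hα s y)
      ((hasDerivAt_kernelFactor_left hα.derivFst x y).add
        (hasDerivAt_kernelFactor_left hα.derivSnd x y)),
    iteratedDeriv_two_eq (fun s => hasDerivAt_kernelFactor_right hα x s)
      ((hasDerivAt_kernelFactor_right hα.derivFst x y).sub
        (hasDerivAt_kernelFactor_right hα.derivSnd x y)), derivSnd_derivFst]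
  ring

theorem IsGoursatSeries.derivFst_derivSnd {Λ : ℂ} {w a : ℕ → ℂ⟦X⟧} (h : IsGoursatSeries Λ w a) :
    derivFst (derivSnd (rows a)) = fun k => Λ * rows (rowProduct w a) k := by
  funext k
  have := h.coeff_eq k.1 k.2
  simp only [derivFst, derivSnd]
  simp only [rows] at this ⊢
  rw [← this]
  ring

/-- By the recursion the product is Λ⁻¹ times a mixed derivative of an entire double series; this is
where Λ ≠ 0 matters. -/
theorem IsGoursatSeries.isEntireDouble_rowProduct {Λ : ℂ} (hΛ : Λ ≠ 0) {w a : ℕ → ℂ⟦X⟧}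
    (h : IsGoursatSeries Λ w a) (ha : IsEntireDouble (rows a)) :
    IsEntireDouble (rows (rowProduct w a)) := by
  intro r hr
  obtain ⟨M, hM⟩ := ha.derivSnd.derivFst r hr
  refine ⟨‖Λ‖⁻¹ * M, fun k => ?_⟩
  have h1 := hM k
  rw [h.derivFst_derivSnd, norm_mul, mul_assoc] at h1
  rwa [le_inv_mul_iff₀ (norm_pos_iff.2 hΛ)]

theorem evalDouble_const_mul (c : ℂ) (α : ℕ × ℕ → ℂ) (z : ℂ × ℂ) :
    evalDouble (fun k => c * α k) z = c * evalDouble α z := by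
  simp only [evalDouble, mul_assoc, tsum_mul_left]

/-- The entire series of `u ↦ V (u / 2)`. -/
structure IsHalfSeries (V : ℝ → ℝ) (U : ℂ⟦X⟧) : Prop where
  isEntire : IsEntireSeries U
  eval : ∀ x : ℝ, evalSeries ((2 * x : ℝ) : ℂ) U = V x

/-- Since ∂²/∂x² - ∂²/∂y² = 4 ∂²/∂u∂v and the odd part of U is half of V(x) - V(y), the constants
match: (ħ²/2μ) · 4 · (μ/ħ²) · 1/2 = 1. -/
theorem isTimeKernelSolution_kernelFactor {ħ μ : ℝ} (hħ : 0 < ħ) (hμ : 0 < μ) {V : ℝ → ℝ}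
    {U : ℂ⟦X⟧} (hU : IsHalfSeries V U) {a : ℕ → ℂ⟦X⟧} (ha : IsEntireDouble (rows a))
    (h : IsGoursatSeries ((μ / ħ ^ 2 : ℝ) : ℂ) (oddPart U) a) :
    IsTimeKernelSolution ħ μ V (fun x => evalSeries ((2 * x : ℝ) : ℂ) (a 0))
      (fun x => ∑' n, rows a (0, n) * ((2 * x : ℝ) : ℂ) ^ n) (kernelFactor (rows a)) where
  contDiff := contDiff_kernelFactor ha
  equation x y := by
    have hΛ : ((μ / ħ ^ 2 : ℝ) : ℂ) ≠ 0 := by exact_mod_cast (by positivity : μ / ħ ^ 2 ≠ 0)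
    have h1 := iteratedDeriv_kernelFactor_sub ha x y
    have h2 : kernelFactor (derivFst (derivSnd (rows a))) x y =
        ((μ / ħ ^ 2 : ℝ) : ℂ) * (((V x : ℂ) - V y) / 2 * kernelFactor (rows a) x y) := by
      rw [h.derivFst_derivSnd, kernelFactor, evalDouble_const_mul,
        evalDouble_mul (isEntireDouble_oddPart hU.isEntire) ha
          (h.isEntireDouble_rowProduct hΛ ha), evalDouble_oddPart hU.isEntire,
        ← hU.eval x, ← hU.eval y, kernelFactor]
      congr 6
      · push_cast; ring
      · push_cast; ring
    have hħ' : (ħ : ℂ) ≠ 0 := by exact_mod_cast hħ.ne'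
    have hμ' : (μ : ℂ) ≠ 0 := by exact_mod_cast hμ.ne'
    rw [h2] at h1
    push_cast at h1
    rw [sub_eq_iff_eq_add] at h1
    rw [h1]
    field_simp
    ring
  diag x := by
    have h1 := hasSum_rows ha ((2 * x : ℝ) : ℂ) 0
    have h2 := h1.unique (hasSum_single 0 fun n hn => by simp [hn])
    rw [kernelFactor, sub_self, ← two_mul, Complex.ofReal_zero, h2]
    simp
  antidiag x := by
    have h1 := hasSum_rows ha 0 ((2 * x : ℝ) : ℂ)
    rw [kernelFactor, add_neg_cancel, sub_neg_eq_add, ← two_mul, Complex.ofReal_zero,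
      ← h1.tsum_eq]
    simp only [evalSeries_at_zero, rows]

theorem hasKernelPowerSeries_kernelFactor {α : ℕ × ℕ → ℂ} (hα : IsEntireDouble α) :
    HasKernelPowerSeries (kernelFactor α) :=
  ⟨α, fun x y => (hα.summable (((x + y : ℝ) : ℂ), ((x - y : ℝ) : ℂ))).hasSum⟩

/-! ### Existence of Goursat solutions by recursion on rows. -/

/-- The first `n` steps of a recursion in which every term depends on all the previous ones. -/
def recursionStep {β : Type*} (x : β) (step : ℕ → (ℕ → β) → β) : ℕ → ℕ → β
  | 0 => fun _ => x
  | n + 1 => Function.update (recursionStep x step n) (n + 1) (step n (recursionStep x step n))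

/-- The sequence with first term `x` whose term with index `n + 1` is `step n` applied to the
sequence. -/
def recursionSeq {β : Type*} (x : β) (step : ℕ → (ℕ → β) → β) (n : ℕ) : β :=
  recursionStep x step n n

theorem recursionSeq_zero {β : Type*} (x : β) (step : ℕ → (ℕ → β) → β) :
    recursionSeq x step 0 = x := rfl

theorem recursionStep_eq {β : Type*} (x : β) (step : ℕ → (ℕ → β) → β) {n j : ℕ} (h : j ≤ n) :
    recursionStep x step n j = recursionSeq x step j := by
  induction n, h using Nat.le_induction with
  | base => rfl
  | succ n hn ih => rw [recursionStep, Function.update_of_ne (by omega), ih]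

theorem recursionSeq_succ {β : Type*} (x : β) {step : ℕ → (ℕ → β) → β}
    (hstep : ∀ n a b, (∀ j ≤ n, a j = b j) → step n a = step n b) (n : ℕ) :
    recursionSeq x step (n + 1) = step n (recursionSeq x step) := by
  rw [recursionSeq, recursionStep, Function.update_self]
  exact hstep n _ _ fun j hj => recursionStep_eq x step hj

theorem rowProduct_congr (w : ℕ → ℂ⟦X⟧) {a b : ℕ → ℂ⟦X⟧} {n : ℕ} (h : ∀ j ≤ n, a j = b j) :
    rowProduct w a n = rowProduct w b n := by
  refine Finset.sum_congr rfl fun p hp => ?_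
  have e : p.1 + p.2 = n := mem_antidiagonal.1 hp
  rw [h p.2 (by omega)]

/-- The rows of the solution of the Goursat problem with the row `f` at `y = 0` and the value
`0` at `x = 0`. -/
def goursatRows (Λ : ℂ) (w : ℕ → ℂ⟦X⟧) (f : ℂ⟦X⟧) : ℕ → ℂ⟦X⟧ :=
  recursionSeq f fun n a => antideriv ((Λ / ((n : ℂ) + 1)) • rowProduct w a n)

theorem goursatRows_succ (Λ : ℂ) (w : ℕ → ℂ⟦X⟧) (f : ℂ⟦X⟧) (n : ℕ) :
    goursatRows Λ w f (n + 1) =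
      antideriv ((Λ / ((n : ℂ) + 1)) • rowProduct w (goursatRows Λ w f) n) :=
  recursionSeq_succ f (fun n a b h => by rw [rowProduct_congr w h]) n

theorem isGoursatSeries_goursatRows (Λ : ℂ) (w : ℕ → ℂ⟦X⟧) (f : ℂ⟦X⟧) :
    IsGoursatSeries Λ w (goursatRows Λ w f) := by
  intro n
  have hn : (n : ℂ) + 1 ≠ 0 := by exact_mod_cast n.succ_ne_zero
  rw [goursatRows_succ, derivative_antideriv, smul_smul, mul_div_cancel₀ _ hn]

theorem rows_goursatRows_zero (Λ : ℂ) (w : ℕ → ℂ⟦X⟧) {f : ℂ⟦X⟧} (hf : constantCoeff f = 0)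
    (n : ℕ) : rows (goursatRows Λ w f) (0, n) = 0 := by
  rw [rows, coeff_zero_eq_constantCoeff_apply]
  rcases n with _ | n
  · exact hf
  · rw [goursatRows_succ, constantCoeff_antideriv]

theorem isEntireDouble_goursatRows (Λ : ℂ) {U : ℂ⟦X⟧} (hU : IsEntireSeries U) {f : ℂ⟦X⟧}
    (hf : IsEntireSeries f) (hf0 : constantCoeff f = 0) :
    IsEntireDouble (rows (goursatRows Λ (oddPart U) f)) :=
  (isGoursatSeries_goursatRows Λ _ f).isEntireDouble (isEntireDouble_oddPart hU) hf
    fun r _ => ⟨0, fun n => by rw [rows_goursatRows_zero Λ _ hf0]; simp⟩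

theorem IsHalfSeries.continuous {V : ℝ → ℝ} {U : ℂ⟦X⟧} (hU : IsHalfSeries V U) :
    Continuous V := by
  have h1 : Continuous fun z => evalSeries z U :=
    continuous_iff_continuousAt.2 fun z => (hasDerivAt_evalSeries hU.isEntire z).continuousAt
  have h2 : Continuous fun x : ℝ => (V x : ℂ) := by
    simp only [← hU.eval]
    fun_prop
  exact Complex.continuous_re.comp h2

theorem exists_isHalfSeries {V : ℝ → ℝ} (hV : IsEntirePotential V) :
    ∃ U, IsHalfSeries V U := by
  obtain ⟨f, hf, hfV⟩ := hV
  have h : ∀ z : ℂ, HasSum (fun n => coeff n (PowerSeries.mk fun n =>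
      ((n.factorial : ℂ))⁻¹ * iteratedDeriv n f 0 / 2 ^ n : ℂ⟦X⟧) * z ^ n) (f (z / 2)) := by
    intro z
    have := Complex.hasSum_taylorSeries_of_entire hf 0 (z / 2)
    refine (congrArg (HasSum · _) (funext fun n => ?_)).mpr this
    simp only [coeff_mk, sub_zero, smul_eq_mul, div_pow]
    ring
  refine ⟨_, fun z => (h z).summable, fun x => ?_⟩
  rw [evalSeries, (h _).tsum_eq, ← hfV]
  congr 1
  push_cast
  ring

/-! ### Calculus of inverse powers of Q = p² - 2U. -/

/-- The sequence `d` stands for the series `∑ dₘ p^{-(2M+2+2m)}` in powers of a momentum `p`;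
this is the operator `-p⁻¹ ∂/∂p` on such series. -/
def momDeriv (M : ℕ) (d : ℕ → ℂ⟦X⟧) : ℕ → ℂ⟦X⟧
  | 0 => 0
  | m + 1 => (2 * ((M : ℂ) + 1 + m)) • d m

/-- The operator `∂²/∂p²` on the series in powers of a momentum `p`. -/
def momDeriv₂ (M : ℕ) (d : ℕ → ℂ⟦X⟧) (m : ℕ) : ℂ⟦X⟧ :=
  (2 * (M : ℂ) + 1 + 2 * m) • momDeriv M d m

/-- The expansion of `(p² - 2U)^{-(M+1+k)}` in powers of `p`. -/
def invPow (M : ℕ) (U : ℂ⟦X⟧) (k m : ℕ) : ℂ⟦X⟧ :=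
  ((((M + m).choose (M + k) : ℂ)) * 2 ^ (m - k)) • U ^ (m - k)

theorem momDeriv_add (M : ℕ) (d e : ℕ → ℂ⟦X⟧) :
    momDeriv M (d + e) = momDeriv M d + momDeriv M e := by
  funext m
  rcases m with _ | m <;> simp [momDeriv]

theorem momDeriv_zero (M : ℕ) : momDeriv M 0 = 0 := by
  funext m
  rcases m with _ | m <;> simp [momDeriv]

theorem momDeriv₂_add (M : ℕ) (d e : ℕ → ℂ⟦X⟧) :
    momDeriv₂ M (d + e) = momDeriv₂ M d + momDeriv₂ M e := by
  funext m
  simp [momDeriv₂, momDeriv_add]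

theorem momDeriv₂_zero (M : ℕ) : momDeriv₂ M 0 = 0 := by
  funext m
  simp [momDeriv₂, momDeriv_zero]

theorem choose_mul_sub (M m k : ℕ) (h : k ≤ m) :
    ((M + m).choose (M + k) : ℂ) * (m - k) = (M + m).choose (M + (k + 1)) * (M + 1 + k) := by
  have h1 := Nat.choose_succ_right_eq (M + m) (M + k)
  have h2 : M + m - (M + k) = m - k := by omega
  rw [h2] at h1
  have h3 := congrArg (Nat.cast (R := ℂ)) h1
  push_cast [Nat.cast_sub h] at h3
  rw [← h3, ← add_assoc]
  ring

/-- In coefficients: -p⁻¹ ∂/∂p of Q^(-j) is 2j Q^(-j-1), here with j = M + 1 + k. -/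
theorem momDeriv_invPow (M : ℕ) (U e : ℂ⟦X⟧) (k : ℕ) :
    momDeriv M (fun m => e * invPow M U k m) =
      fun m => ((2 * ((M : ℂ) + 1 + k)) • e) * invPow M U (k + 1) m := by
  funext m
  rcases m with _ | m
  · rw [invPow, Nat.choose_eq_zero_of_lt (by omega)]
    simp [momDeriv]
  · have h1 := congrArg (Nat.cast (R := ℂ)) (Nat.add_one_mul_choose_eq (M + m) (M + k))
    push_cast at h1
    rw [momDeriv, invPow, invPow, Nat.add_sub_add_right, mul_smul_comm, smul_smul, mul_smul_comm,
      smul_mul_assoc, smul_smul]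
    congr 1
    rw [show M + (m + 1) = M + m + 1 by ring, show M + (k + 1) = M + k + 1 by ring]
    linear_combination 2 * 2 ^ (m - k) * h1

/-- The Euler operator p ∂/∂p on Q^(-(M+1+k)), rewritten with p² = Q + 2U. It removes the explicit
index m from the second momentum derivative. -/
theorem natCast_smul_invPow (M : ℕ) (U : ℂ⟦X⟧) (k m : ℕ) :
    (m : ℂ) • invPow M U k m =
      (k : ℂ) • invPow M U k m + (2 * ((M : ℂ) + 1 + k)) • (U * invPow M U (k + 1) m) := by
  -- For m < k the truncated exponent m - k is harmless, because the binomial coefficients vanish.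
  rcases lt_or_ge m k with h | h
  · rw [invPow, invPow, Nat.choose_eq_zero_of_lt (by omega), Nat.choose_eq_zero_of_lt (by omega)]
    simp
  have h1 := choose_mul_sub M m k h
  rcases h.eq_or_lt with h | h
  · subst h
    rw [invPow, invPow, Nat.choose_eq_zero_of_lt (by omega : M + k < M + (k + 1))]
    simp
  · obtain ⟨i, rfl⟩ : ∃ i, m = k + 1 + i := ⟨m - (k + 1), by omega⟩
    rw [invPow, invPow, show k + 1 + i - k = i + 1 by omega, Nat.add_sub_cancel_left, mul_smul_comm,
      ← pow_succ', smul_smul, smul_smul, smul_smul, ← add_smul]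
    congr 1
    linear_combination 2 ^ (i + 1) * h1

theorem derivative_invPow (M : ℕ) (U : ℂ⟦X⟧) (k m : ℕ) :
    d⁄dX ℂ (invPow M U k m) =
      d⁄dX ℂ U * ((2 * ((M : ℂ) + 1 + k)) • invPow M U (k + 1) m) := by
  rcases le_or_gt m k with h | h
  · rw [invPow, invPow, Nat.choose_eq_zero_of_lt (by omega : M + m < M + (k + 1)),
      Nat.sub_eq_zero_of_le h]
    simp
  · have h1 := choose_mul_sub M m k h.le
    obtain ⟨i, rfl⟩ : ∃ i, m = k + 1 + i := ⟨m - (k + 1), by omega⟩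
    rw [invPow, invPow, show k + 1 + i - k = i + 1 by omega, Nat.add_sub_cancel_left, Derivation.map_smul,
      derivative_pow, Nat.add_sub_cancel, smul_smul, mul_smul_comm, mul_comm (d⁄dX ℂ U),
      mul_assoc, show ((i + 1 : ℕ) : ℂ⟦X⟧) = C ((i : ℂ) + 1) by simp, ← smul_eq_C_mul, smul_smul]
    congr 1
    push_cast at h1
    linear_combination 2 ^ (i + 1) * h1

theorem momDeriv₂_invPow (M : ℕ) (U e : ℂ⟦X⟧) (k : ℕ) :
    momDeriv₂ M (fun m => e * invPow M U k m) =
      (fun m => (((2 * (M : ℂ) + 1 + 2 * (k + 1)) * (2 * ((M : ℂ) + 1 + k))) • e) *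
        invPow M U (k + 1) m) +
      fun m => ((2 * 2 * ((M : ℂ) + 1 + (k + 1)) * (2 * ((M : ℂ) + 1 + k))) • (U * e)) *
        invPow M U (k + 2) m := by
  funext m
  have h := natCast_smul_invPow M U (k + 1) m
  rw [momDeriv₂, momDeriv_invPow, Pi.add_apply]
  push_cast at h
  simp only [smul_eq_C_mul, map_add, map_mul, map_one] at h ⊢
  linear_combination (C (2 : ℂ) * C (2 : ℂ) * (C (M : ℂ) + 1 + C (k : ℂ)) * e) * h

/-- The finite sums of the expansions of `(p² - 2U)^{-(M+1+k)}` with entire coefficients. -/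
def invPowSpan (M : ℕ) (U : ℂ⟦X⟧) : AddSubmonoid (ℕ → ℂ⟦X⟧) :=
  AddSubmonoid.closure {d | ∃ e k, IsEntireSeries e ∧ d = fun m => e * invPow M U k m}

theorem mul_invPow_mem {M : ℕ} {U e : ℂ⟦X⟧} (he : IsEntireSeries e) (k : ℕ) :
    (fun m => e * invPow M U k m) ∈ invPowSpan M U :=
  AddSubmonoid.subset_closure ⟨e, k, he, rfl⟩

theorem momDeriv_mem {M : ℕ} {U : ℂ⟦X⟧} {d : ℕ → ℂ⟦X⟧} (hd : d ∈ invPowSpan M U) :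
    momDeriv M d ∈ invPowSpan M U := by
  induction hd using AddSubmonoid.closure_induction with
  | mem d h =>
    obtain ⟨e, k, he, rfl⟩ := h
    rw [momDeriv_invPow]
    exact mul_invPow_mem (he.smul _) _
  | zero => rw [momDeriv_zero]; exact zero_mem _
  | add d e _ _ hd he => rw [momDeriv_add]; exact add_mem hd he

theorem momDeriv₂_mem {M : ℕ} {U : ℂ⟦X⟧} (hU : IsEntireSeries U) {d : ℕ → ℂ⟦X⟧}
    (hd : d ∈ invPowSpan M U) : momDeriv₂ M d ∈ invPowSpan M U := by
  induction hd using AddSubmonoid.closure_induction with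
  | mem d h =>
    obtain ⟨e, k, he, rfl⟩ := h
    rw [momDeriv₂_invPow]
    exact add_mem (mul_invPow_mem (he.smul _) _) (mul_invPow_mem ((hU.mul he).smul _) _)
  | zero => rw [momDeriv₂_zero]; exact zero_mem _
  | add d e _ _ hd he => rw [momDeriv₂_add]; exact add_mem hd he

theorem mul_mem_invPowSpan {M : ℕ} {U f : ℂ⟦X⟧} (hf : IsEntireSeries f) {d : ℕ → ℂ⟦X⟧}
    (hd : d ∈ invPowSpan M U) : (fun m => f * d m) ∈ invPowSpan M U := by
  induction hd using AddSubmonoid.closure_induction with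
  | mem d h =>
    obtain ⟨e, k, he, rfl⟩ := h
    simp only [← mul_assoc]
    exact mul_invPow_mem (hf.mul he) _
  | zero => simp only [Pi.zero_apply, mul_zero]; exact zero_mem (invPowSpan M U)
  | add d e _ _ hd he => simpa only [Pi.add_apply, mul_add] using! add_mem hd he

theorem isEntireSeries_of_mem_invPowSpan {M : ℕ} {U : ℂ⟦X⟧} (hU : IsEntireSeries U)
    {d : ℕ → ℂ⟦X⟧} (hd : d ∈ invPowSpan M U) (m : ℕ) : IsEntireSeries (d m) := by
  induction hd using AddSubmonoid.closure_induction with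
  | mem d h =>
    obtain ⟨e, k, he, rfl⟩ := h
    exact he.mul ((hU.pow _).smul _)
  | zero => exact IsEntireSeries.zero
  | add d e _ _ hd he => exact hd.add he

/-! ### Transport equations and the Moyal expansion. -/

/-- The solution of the transport equation `d' = U' (momDeriv d) + g` with the value `0` at the
origin. -/
def transportSol (M : ℕ) (U : ℂ⟦X⟧) (g : ℕ → ℂ⟦X⟧) : ℕ → ℂ⟦X⟧
  | 0 => antideriv (g 0)
  | m + 1 => antideriv (d⁄dX ℂ U * ((2 * ((M : ℂ) + 1 + m)) • transportSol M U g m) + g (m + 1))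

theorem derivative_transportSol (M : ℕ) (U : ℂ⟦X⟧) (g : ℕ → ℂ⟦X⟧) (m : ℕ) :
    d⁄dX ℂ (transportSol M U g m) = d⁄dX ℂ U * momDeriv M (transportSol M U g) m + g m := by
  rcases m with _ | m
  · simp [transportSol, momDeriv, derivative_antideriv]
  · rw [transportSol, derivative_antideriv, momDeriv]

theorem constantCoeff_transportSol (M : ℕ) (U : ℂ⟦X⟧) (g : ℕ → ℂ⟦X⟧) (m : ℕ) :
    constantCoeff (transportSol M U g m) = 0 := by
  rcases m with _ | m <;> rw [transportSol, constantCoeff_antideriv]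

/-- `momDeriv` raises the index by one, so the equation at m + 1 involves only d m on its right-hand
side and determines d (m + 1) up to its constant term. -/
theorem eq_transportSol {M : ℕ} {U : ℂ⟦X⟧} {g d : ℕ → ℂ⟦X⟧}
    (hd : ∀ m, d⁄dX ℂ (d m) = d⁄dX ℂ U * momDeriv M d m + g m)
    (h0 : ∀ m, constantCoeff (d m) = 0) : transportSol M U g = d := by
  funext m
  induction m with
  | zero =>
    refine derivative.ext ?_ ?_
    · rw [derivative_transportSol, hd]; rfl
    · rw [constantCoeff_transportSol, h0]
  | succ m ih =>
    refine derivative.ext ?_ ?_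
    · rw [derivative_transportSol, hd, momDeriv, momDeriv, ih]
    · rw [constantCoeff_transportSol, h0]

/-- The operator d ↦ d' - U' (momDeriv d) is a derivation in spirit that annihilates every power of
Q. Hence a source e Q^(-j) is solved by integrating the coefficient e alone. -/
theorem transportSol_mem {M : ℕ} {U : ℂ⟦X⟧} {g : ℕ → ℂ⟦X⟧} (hg : g ∈ invPowSpan M U) :
    transportSol M U g ∈ invPowSpan M U := by
  induction hg using AddSubmonoid.closure_induction with
  | mem g h =>
    obtain ⟨e, k, he, rfl⟩ := h
    rw [eq_transportSol (d := fun m => antideriv e * invPow M U k m)]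
    · exact mul_invPow_mem he.antideriv k
    · intro m
      rw [Derivation.leibniz, derivative_antideriv, momDeriv_invPow, derivative_invPow]
      simp only [smul_eq_mul, smul_eq_C_mul]
      ring
    · intro m
      rw [map_mul, constantCoeff_antideriv, zero_mul]
  | zero =>
    rw [eq_transportSol (d := 0)]
    · exact zero_mem _
    · intro m; simp [momDeriv_zero]
    · intro m; simp
  | add g h _ _ hg hh =>
    rw [eq_transportSol (d := transportSol M U g + transportSol M U h)]
    · exact add_mem hg hh
    · intro m
      rw [Pi.add_apply, map_add, derivative_transportSol, derivative_transportSol, momDeriv_add,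
        Pi.add_apply, Pi.add_apply]
      ring
    · intro m
      rw [Pi.add_apply, map_add, constantCoeff_transportSol, constantCoeff_transportSol, add_zero]

/-- The inhomogeneity of the transport equation for the term with index `s + 1` of the expansion
in powers of `ħ²`. -/
def transportSource (M : ℕ) (U : ℂ⟦X⟧) (s : ℕ) (D : ℕ → ℕ → ℂ⟦X⟧) : ℕ → ℂ⟦X⟧ :=
  ∑ p ∈ antidiagonal s, fun m =>
    oddPart U (2 * (p.1 + 1) + 1) * momDeriv M ((momDeriv₂ M)^[p.1 + 1] (D p.2)) m

/-- The terms of the expansion in powers of `ħ²` of the solution of the Moyal equation with the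
leading term `(p² - 2U)^{-(M+1)}`. -/
def moyalTerm (M : ℕ) (U : ℂ⟦X⟧) : ℕ → ℕ → ℂ⟦X⟧ :=
  recursionSeq (invPow M U 0) fun s D => transportSol M U (transportSource M U s D)

theorem moyalTerm_succ (M : ℕ) (U : ℂ⟦X⟧) (s : ℕ) :
    moyalTerm M U (s + 1) = transportSol M U (transportSource M U s (moyalTerm M U)) := by
  refine recursionSeq_succ (invPow M U 0) (fun s D D' h => ?_) s
  congr 1
  refine Finset.sum_congr rfl fun p hp => ?_
  have e : p.1 + p.2 = s := mem_antidiagonal.1 hp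
  rw [h p.2 (by omega)]

theorem oddPart_one (U : ℂ⟦X⟧) : oddPart U 1 = d⁄dX ℂ U := by
  ext n
  simp [oddPart, coeff_derivative]

/-- This finite form is what makes every order in ħ converge in the same region as the leading term.
-/
theorem moyalTerm_mem {M : ℕ} {U : ℂ⟦X⟧} (hU : IsEntireSeries U) (s : ℕ) :
    moyalTerm M U s ∈ invPowSpan M U := by
  induction s using Nat.strong_induction_on with
  | _ s ih =>
  rcases s with _ | s
  · have h : moyalTerm M U 0 = fun m => C (1 : ℂ) * invPow M U 0 m := by
      funext m
      rw [map_one, one_mul]; rfl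
    rw [h]
    exact mul_invPow_mem (IsEntireSeries.C 1) 0
  · rw [moyalTerm_succ]
    refine transportSol_mem (sum_mem fun p hp => ?_)
    have e : p.1 + p.2 = s := mem_antidiagonal.1 hp
    refine mul_mem_invPowSpan (isEntireSeries_of_rows (isEntireDouble_oddPart hU) _)
      (momDeriv_mem ?_)
    have hit : ∀ j, (momDeriv₂ M)^[j] (moyalTerm M U p.2) ∈ invPowSpan M U := by
      intro j
      induction j with
      | zero => exact ih p.2 (by omega)
      | succ j hj => rw [Function.iterate_succ_apply']; exact momDeriv₂_mem hU hj
    exact hit _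

/-- The Moyal equation p ∂F/∂u + ∑ⱼ U^(2j+1)/(2j+1)! ∂^(2j+1)F/∂p^(2j+1) = 0, sorted by order, with
U^(2j+1) the derivative of that order. The summand j = 0 is the transport term; the others form the
source. -/
theorem derivative_moyalTerm (M : ℕ) (U : ℂ⟦X⟧) (s m : ℕ) :
    d⁄dX ℂ (moyalTerm M U s m) = ∑ p ∈ antidiagonal s,
      oddPart U (2 * p.1 + 1) * momDeriv M ((momDeriv₂ M)^[p.1] (moyalTerm M U p.2)) m := by
  rcases s with _ | s
  · have h := momDeriv_invPow M U 1 0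
    simp only [one_mul] at h
    have h0 : moyalTerm M U 0 = fun m => invPow M U 0 m := rfl
    simp only [Finset.Nat.antidiagonal_zero, Finset.sum_singleton, mul_zero, zero_add, oddPart_one,
      Function.iterate_zero, id_eq, h0, h, derivative_invPow, smul_mul_assoc, one_mul]
  · rw [Finset.Nat.sum_antidiagonal_succ, moyalTerm_succ, derivative_transportSol,
      ← moyalTerm_succ, transportSource, Finset.sum_apply, mul_zero, zero_add, oddPart_one]
    rfl

theorem constantCoeff_moyalTerm {M : ℕ} {U : ℂ⟦X⟧} (hU : constantCoeff U = 0) (s m : ℕ) :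
    constantCoeff (moyalTerm M U s m) = if s = 0 ∧ m = 0 then 1 else 0 := by
  rcases s with _ | s
  · rw [show moyalTerm M U 0 = invPow M U 0 from rfl, invPow, ← coeff_zero_eq_constantCoeff_apply,
      map_smul, coeff_zero_eq_constantCoeff_apply, map_pow, hU]
    rcases m with _ | m <;> simp
  · rw [moyalTerm_succ, constantCoeff_transportSol]
    simp

theorem momDeriv_iterate_eq_zero (M j : ℕ) (d : ℕ → ℂ⟦X⟧) {m : ℕ} (h : m ≤ j) :
    momDeriv M ((momDeriv₂ M)^[j] d) m = 0 := by
  induction j generalizing d m with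
  | zero => obtain rfl : m = 0 := by omega
            rfl
  | succ j ih =>
    rw [Function.iterate_succ_apply']
    rcases m with _ | m
    · rfl
    · rw [momDeriv, momDeriv₂, ih d (by omega), smul_zero, smul_zero]

/-- Each derivative of a power of p yields consecutive integers, which collapse to a quotient of
factorials. These match the factorials by which the rows of the kernel factor are divided. -/
theorem momDeriv_iterate (M j : ℕ) (d : ℕ → ℂ⟦X⟧) (t : ℕ) :
    momDeriv M ((momDeriv₂ M)^[j] d) (j + t + 1) =
      (((2 * M + 2 + 2 * (j + t)).factorial : ℂ) / ((2 * M + 1 + 2 * t).factorial : ℂ)) • d t := by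
  have hne : ∀ n : ℕ, (n.factorial : ℂ) ≠ 0 := fun n => by exact_mod_cast n.factorial_ne_zero
  induction j generalizing d t with
  | zero =>
    rw [Function.iterate_zero, id_eq, zero_add, momDeriv]
    congr 1
    rw [show 2 * M + 2 + 2 * t = 2 * M + 1 + 2 * t + 1 by ring, Nat.factorial_succ]
    have := hne (2 * M + 1 + 2 * t)
    push_cast
    field_simp
    ring
  | succ j ih =>
    rw [Function.iterate_succ_apply, show j + 1 + t = j + (t + 1) by ring, ih (momDeriv₂ M d) (t + 1),
      momDeriv₂, momDeriv, smul_smul, smul_smul]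
    congr 1
    rw [show 2 * M + 1 + 2 * (t + 1) = 2 * M + 1 + 2 * t + 1 + 1 by ring, Nat.factorial_succ,
      Nat.factorial_succ]
    have := hne (2 * M + 1 + 2 * t)
    have h1 : (2 * (M : ℂ) + 1 + 2 * t + 1) ≠ 0 := by
      exact_mod_cast (by omega : 2 * M + 1 + 2 * t + 1 ≠ 0)
    have h2 : (2 * (M : ℂ) + 1 + 2 * t + 1 + 1) ≠ 0 := by
      exact_mod_cast (by omega : 2 * M + 1 + 2 * t + 1 + 1 ≠ 0)
    push_cast
    field_simp
    ring

/-- On the right of the Moyal equation D_(s-j) occurs at index m - j - 1, again below its order, and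
the constant terms vanish. So only s ≤ m contribute to a given row. -/
theorem moyalTerm_eq_zero {M : ℕ} {U : ℂ⟦X⟧} (hU : constantCoeff U = 0) {s m : ℕ} (h : m < s) :
    moyalTerm M U s m = 0 := by
  induction m using Nat.strong_induction_on generalizing s with
  | _ m ih =>
  refine derivative.ext ?_ ?_
  · rw [derivative_moyalTerm, map_zero]
    refine Finset.sum_eq_zero fun p hp => ?_
    have e : p.1 + p.2 = s := mem_antidiagonal.1 hp
    rcases le_or_gt m p.1 with h1 | h1
    · rw [momDeriv_iterate_eq_zero _ _ _ h1, mul_zero]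
    · obtain ⟨t, rfl⟩ : ∃ t, m = p.1 + t + 1 := ⟨m - p.1 - 1, by omega⟩
      rw [momDeriv_iterate, ih t (by omega) (by omega), smul_zero, mul_zero]
  · rw [constantCoeff_moyalTerm hU, map_zero, if_neg (by omega)]

/-! ### The rows of T_C from the Moyal expansion. -/

/-- The partial sum of the expansion of the solution of the Moyal equation that contributes to
the row with index `2M+1+2m` of the kernel factor. -/
def moyalSum (M : ℕ) (U : ℂ⟦X⟧) (Λ : ℂ) (m : ℕ) : ℂ⟦X⟧ :=
  ∑ s ∈ Finset.range (m + 1), Λ ^ (m - s) • moyalTerm M U s m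

theorem derivative_moyalSum_zero {M : ℕ} {U : ℂ⟦X⟧} (Λ : ℂ) :
    d⁄dX ℂ (moyalSum M U Λ 0) = 0 := by
  simp [moyalSum, derivative_moyalTerm, momDeriv]

theorem derivative_moyalSum_succ {M : ℕ} {U : ℂ⟦X⟧} (hU : constantCoeff U = 0) (Λ : ℂ) (m : ℕ) :
    d⁄dX ℂ (moyalSum M U Λ (m + 1)) = Λ • ∑ p ∈ antidiagonal m,
      (((2 * M + 2 + 2 * m).factorial : ℂ) / ((2 * M + 1 + 2 * p.2).factorial : ℂ)) •
        (oddPart U (2 * p.1 + 1) * moyalSum M U Λ p.2) := by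
  set f : ℕ → ℕ → ℂ⟦X⟧ := fun j t => Λ ^ (m + 1 - (j + t)) •
    (oddPart U (2 * j + 1) * momDeriv M ((momDeriv₂ M)^[j] (moyalTerm M U t)) (m + 1)) with hf
  have h1 : d⁄dX ℂ (moyalSum M U Λ (m + 1)) =
      ∑ s ∈ Finset.range (m + 2), ∑ j ∈ Finset.range (s + 1), f j (s - j) := by
    rw [moyalSum, map_sum]
    refine Finset.sum_congr rfl fun s _ => ?_
    rw [Derivation.map_smul, derivative_moyalTerm, Finset.Nat.sum_antidiagonal_eq_sum_range_succ_mk,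
      Finset.smul_sum]
    refine Finset.sum_congr rfl fun j hj => ?_
    have hj' : j + (s - j) = s := by have := Finset.mem_range.1 hj; omega
    simp only [hf, hj']
  -- Exchanging the sums groups the terms by j. The block j = m + 1 vanishes because its derivatives
  -- shift past the index, and in each other block the top order t + 1 exceeds the index t.
  rw [h1, Finset.sum_range_diag_flip, Finset.sum_range_succ,
    Finset.Nat.sum_antidiagonal_eq_sum_range_succ_mk, Finset.smul_sum,
    Finset.sum_eq_zero (s := Finset.range (m + 2 - (m + 1))), add_zero]
  · refine Finset.sum_congr rfl fun j hj => ?_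
    obtain ⟨t, rfl⟩ : ∃ t, m = j + t := ⟨m - j, by have := Finset.mem_range.1 hj; omega⟩
    have hd : ∀ s, f j s = Λ ^ (j + t + 1 - (j + s)) • (oddPart U (2 * j + 1) *
        (((2 * M + 2 + 2 * (j + t)).factorial : ℂ) / ((2 * M + 1 + 2 * t).factorial : ℂ)) •
          moyalTerm M U s t) := fun s => by
      simp only [hf, momDeriv_iterate]
    rw [show j + t + 2 - j = t + 1 + 1 by omega, Finset.sum_range_succ, hd (t + 1),
      moyalTerm_eq_zero hU (Nat.lt_succ_self t), smul_zero, mul_zero, smul_zero, add_zero,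
      Nat.add_sub_cancel_left, moyalSum, Finset.mul_sum, Finset.smul_sum, Finset.smul_sum]
    refine Finset.sum_congr rfl fun s hs => ?_
    rw [hd, show j + t + 1 - (j + s) = t - s + 1 by have := Finset.mem_range.1 hs; omega,
      mul_smul_comm, mul_smul_comm, smul_smul, smul_smul, smul_smul]
    congr 1
    ring
  · intro t _
    simp only [hf]
    rw [momDeriv_iterate_eq_zero M (m + 1) _ le_rfl, mul_zero, smul_zero]

theorem rowIndex_injective (M : ℕ) : Function.Injective fun m : ℕ => 2 * M + 1 + 2 * m :=
  fun a b h => by simp only at h; omega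

/-- The rows of the difference of the kernel factors. -/
def shiftRows (M : ℕ) (U : ℂ⟦X⟧) (Λ c : ℂ) : ℕ → ℂ⟦X⟧ :=
  Function.extend (fun m : ℕ => 2 * M + 1 + 2 * m)
    (fun m => (c * ((2 * M + 1).factorial : ℂ) / ((2 * M + 1 + 2 * m).factorial : ℂ)) •
      moyalSum M U Λ m) 0

theorem shiftRows_apply (M : ℕ) (U : ℂ⟦X⟧) (Λ c : ℂ) (m : ℕ) :
    shiftRows M U Λ c (2 * M + 1 + 2 * m) =
      (c * ((2 * M + 1).factorial : ℂ) / ((2 * M + 1 + 2 * m).factorial : ℂ)) •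
        moyalSum M U Λ m :=
  (rowIndex_injective M).extend_apply _ _ m

theorem shiftRows_eq_zero (M : ℕ) (U : ℂ⟦X⟧) (Λ c : ℂ) {n : ℕ}
    (h : ∀ m, 2 * M + 1 + 2 * m ≠ n) : shiftRows M U Λ c n = 0 :=
  Function.extend_apply' _ _ _ fun ⟨m, hm⟩ => h m hm

theorem oddPart_of_even (U : ℂ⟦X⟧) {j : ℕ} (h : ¬ Odd j) : oddPart U j = 0 := by
  ext n
  simp [oddPart, h]

/-- The potential has only odd rows and the shift lives in rows 2M+1+2m, so their product lives in
rows 2M+2+2m. There the factor n + 1 of the recursion completes the factorial. -/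
theorem isGoursatSeries_shiftRows {M : ℕ} {U : ℂ⟦X⟧} (hU : constantCoeff U = 0) (Λ c : ℂ) :
    IsGoursatSeries Λ (oddPart U) (shiftRows M U Λ c) := by
  have hne : ∀ n : ℕ, (n.factorial : ℂ) ≠ 0 := fun n => by exact_mod_cast n.factorial_ne_zero
  have hzero : ∀ p : ℕ × ℕ, (∀ j t, p ≠ (2 * j + 1, 2 * M + 1 + 2 * t)) →
      oddPart U p.1 * shiftRows M U Λ c p.2 = 0 := by
    rintro ⟨i, k⟩ h
    by_cases hi : Odd i
    · obtain ⟨j, rfl⟩ := hi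
      rw [shiftRows_eq_zero M U Λ c fun t ht => h j t (Prod.ext rfl ht.symm), mul_zero]
    · rw [oddPart_of_even U hi, zero_mul]
  intro n
  by_cases hn : ∃ m, n = 2 * M + 2 + 2 * m
  · obtain ⟨m, rfl⟩ := hn
    have hprod : rowProduct (oddPart U) (shiftRows M U Λ c) (2 * M + 2 + 2 * m) =
        ∑ p ∈ antidiagonal m,
          oddPart U (2 * p.1 + 1) * shiftRows M U Λ c (2 * M + 1 + 2 * p.2) := by
      symm
      refine Finset.sum_of_injOn (fun p => (2 * p.1 + 1, 2 * M + 1 + 2 * p.2)) ?_ ?_ ?_ ?_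
      · rintro ⟨a, b⟩ _ ⟨a', b'⟩ _ h
        simp only [Prod.mk.injEq] at h ⊢
        omega
      · rintro ⟨a, b⟩ hp
        have e : a + b = m := mem_antidiagonal.1 hp
        exact mem_antidiagonal.2 (show 2 * a + 1 + (2 * M + 1 + 2 * b) = 2 * M + 2 + 2 * m by omega)
      · intro p hp hp'
        refine hzero p fun j t e => hp' ⟨(j, t), ?_, e.symm⟩
        have e' : p.1 + p.2 = 2 * M + 2 + 2 * m := mem_antidiagonal.1 hp
        rw [e] at e'
        exact mem_antidiagonal.2 (show j + t = m by simp only at e'; omega)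
      · intro p _; rfl
    rw [hprod, show 2 * M + 2 + 2 * m + 1 = 2 * M + 1 + 2 * (m + 1) by ring, shiftRows_apply,
      Derivation.map_smul, derivative_moyalSum_succ hU, Finset.smul_sum, Finset.smul_sum,
      Finset.smul_sum, Finset.smul_sum]
    refine Finset.sum_congr rfl fun p _ => ?_
    rw [shiftRows_apply, mul_smul_comm, smul_smul, smul_smul, smul_smul, smul_smul]
    congr 1
    rw [show 2 * M + 1 + 2 * (m + 1) = 2 * M + 2 + 2 * m + 1 by ring,
      Nat.factorial_succ (2 * M + 2 + 2 * m)]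
    have h1 := hne (2 * M + 2 + 2 * m)
    have h2 := hne (2 * M + 1 + 2 * p.2)
    have h3 : 2 * (M : ℂ) + 2 + 2 * m + 1 ≠ 0 := by
      exact_mod_cast (by omega : 2 * M + 2 + 2 * m + 1 ≠ 0)
    push_cast
    generalize 2 * (M : ℂ) + 2 + 2 * m + 1 = y at h3 ⊢
    field_simp
  · have h1 : d⁄dX ℂ (shiftRows M U Λ c (n + 1)) = 0 := by
      by_cases hm : ∃ m, 2 * M + 1 + 2 * m = n + 1
      · obtain ⟨m, hm⟩ := hm
        -- Outside those rows the only possibly nonzero next row is 2M+1, which is constant.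
        obtain rfl : m = 0 := by
          by_contra h0
          exact hn ⟨m - 1, by omega⟩
        rw [← hm, shiftRows_apply, Derivation.map_smul, derivative_moyalSum_zero, smul_zero]
      · rw [shiftRows_eq_zero M U Λ c fun m h => hm ⟨m, h⟩, map_zero]
    have h2 : rowProduct (oddPart U) (shiftRows M U Λ c) n = 0 := by
      refine Finset.sum_eq_zero fun p hp => hzero p fun j t e => hn ⟨j + t, ?_⟩
      have e' : p.1 + p.2 = n := mem_antidiagonal.1 hp
      rw [e] at e'
      simp only at e'
      omega
    rw [h1, h2, smul_zero, smul_zero]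

/-- Only the leading term at index 0 has a nonzero constant coefficient, so the value at u = 0 is
the single monomial c v^(2M+1). -/
theorem rows_shiftRows_zero {M : ℕ} {U : ℂ⟦X⟧} (hU : constantCoeff U = 0) (Λ c : ℂ) (n : ℕ) :
    rows (shiftRows M U Λ c) (0, n) = if n = 2 * M + 1 then c else 0 := by
  rw [rows, coeff_zero_eq_constantCoeff_apply]
  by_cases hn : ∃ m, 2 * M + 1 + 2 * m = n
  · obtain ⟨m, rfl⟩ := hn
    rw [shiftRows_apply, ← coeff_zero_eq_constantCoeff_apply, map_smul,
      coeff_zero_eq_constantCoeff_apply, moyalSum, map_sum]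
    have h : ∀ s, constantCoeff (Λ ^ (m - s) • moyalTerm M U s m) =
        if s = 0 ∧ m = 0 then Λ ^ (m - s) else 0 := fun s => by
      rw [← coeff_zero_eq_constantCoeff_apply, map_smul, coeff_zero_eq_constantCoeff_apply,
        constantCoeff_moyalTerm hU]
      simp
    simp only [h]
    rcases m with _ | m
    · have := (2 * M + 1).factorial_ne_zero
      simp [this]
    · simp
  · rw [shiftRows_eq_zero M U Λ c fun m h => hn ⟨m, h⟩, map_zero, if_neg fun h => hn ⟨0, by omega⟩]

theorem isEntireDouble_shiftRows {M : ℕ} {U : ℂ⟦X⟧} (hU : IsEntireSeries U)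
    (hU0 : constantCoeff U = 0) (Λ c : ℂ) : IsEntireDouble (rows (shiftRows M U Λ c)) := by
  refine (isGoursatSeries_shiftRows hU0 Λ c).isEntireDouble (isEntireDouble_oddPart hU) ?_
    fun r hr => ⟨‖c‖ * r ^ (2 * M + 1), fun n => ?_⟩
  · rw [shiftRows_eq_zero M U Λ c fun m => by omega]
    exact IsEntireSeries.zero
  · rw [rows_shiftRows_zero hU0]
    split_ifs with h
    · rw [h]
    · simp only [norm_zero, zero_mul]; positivity

/-! ### Abel integrals of powers times sgn v. -/

theorem integrableOn_pow_mul_cexp (n : ℕ) {z : ℂ} (hz : 0 < z.re) :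
    IntegrableOn (fun v : ℝ => (v : ℂ) ^ n * Complex.exp (-z * v)) (Set.Ioi 0) := by
  have h := integrableOn_rpow_mul_exp_neg_mul_rpow (s := n) (p := 1) (b := z.re)
    (by linarith [n.cast_nonneg (α := ℝ)]) one_pos hz
  refine (integrable_norm_iff (Continuous.aestronglyMeasurable (by fun_prop))).1 ?_
  refine IntegrableOn.congr_fun h (fun v hv => ?_) measurableSet_Ioi
  have hv' : (0 : ℝ) < v := hv
  simp [Complex.norm_exp, abs_of_pos hv']

theorem integral_pow_mul_cexp (n : ℕ) {z : ℂ} (hz : 0 < z.re) :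
    ∫ v : ℝ in Set.Ioi 0, (v : ℂ) ^ n * Complex.exp (-z * v) = n.factorial / z ^ (n + 1) := by
  have hz0 : z ≠ 0 := fun h => by simp [h] at hz
  induction n with
  | zero =>
    have := integral_exp_mul_complex_Ioi (a := -z) (by simpa using hz) 0
    simpa using this
  | succ n ih =>
    have hd : ∀ v : ℝ, HasDerivAt (fun v : ℝ => (v : ℂ) ^ (n + 1) * Complex.exp (-z * v))
        (((n : ℂ) + 1) * ((v : ℂ) ^ n * Complex.exp (-z * v)) -
          z * ((v : ℂ) ^ (n + 1) * Complex.exp (-z * v))) v := fun v => by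
      have h1 := (hasDerivAt_pow (n + 1) (v : ℂ)).mul
        (((hasDerivAt_id (v : ℂ)).const_mul (-z)).cexp)
      refine h1.comp_ofReal.congr_deriv ?_
      simp only [id, Nat.add_sub_cancel]
      push_cast
      ring
    have hi := (integrableOn_pow_mul_cexp n hz).const_mul ((n : ℂ) + 1)
    have hi' := (integrableOn_pow_mul_cexp (n + 1) hz).const_mul z
    have h0 := tendsto_zero_of_hasDerivAt_of_integrableOn_Ioi (fun v _ => hd v) (hi.sub hi')
      (integrableOn_pow_mul_cexp (n + 1) hz)
    have h := integral_Ioi_of_hasDerivAt_of_tendsto' (a := 0) (fun v _ => hd v) (hi.sub hi') h0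
    rw [integral_sub hi hi', integral_const_mul, integral_const_mul, ih] at h
    simp only [Complex.ofReal_zero, ne_eq, Nat.add_eq_zero_iff, one_ne_zero, and_false,
      not_false_eq_true, zero_pow, zero_mul, sub_zero] at h
    rw [Nat.factorial_succ, pow_succ, eq_div_iff (by positivity)]
    have h2 := sub_eq_zero.1 h
    rw [mul_comm (z ^ (n + 1)) z, ← mul_assoc, mul_comm _ z, ← h2]
    push_cast
    field_simp

/-- With θ = ip/ħ, the half lines contribute n!/(ε+θ)^(n+1) and -(-1)ⁿ n!/(ε-θ)^(n+1). As ε → 0 the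
sign makes the two limits equal, whence the factor 2; p ≠ 0 keeps θ away from the pole. -/
theorem hasAbelIntegral_pow_mul_sign (c : ℂ) (n : ℕ) {ħ p : ℝ} (hħ : 0 < ħ) (hp : p ≠ 0) :
    HasAbelIntegral
      (fun v : ℝ => c * (v : ℂ) ^ n * (Real.sign v : ℂ) *
        Complex.exp (-Complex.I * (v : ℂ) * (p : ℂ) / (ħ : ℂ)))
      (c * (2 * (n.factorial / (Complex.I * p / ħ) ^ (n + 1)))) := by
  set θ : ℂ := Complex.I * p / ħ with hθ
  have hθre : θ.re = 0 := by
    rw [hθ, show Complex.I * (p : ℂ) / ħ = ((p / ħ : ℝ) : ℂ) * Complex.I by push_cast; ring]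
    simp
  have hθ0 : θ ≠ 0 := by
    have h1 : (p : ℂ) ≠ 0 := by exact_mod_cast hp
    have h2 : (ħ : ℂ) ≠ 0 := by exact_mod_cast hħ.ne'
    exact div_ne_zero (mul_ne_zero Complex.I_ne_zero h1) h2
  set F : ℝ → ℝ → ℂ := fun ε v => (Real.exp (-ε * |v|) : ℂ) * (c * (v : ℂ) ^ n *
    (Real.sign v : ℂ) * Complex.exp (-Complex.I * (v : ℂ) * (p : ℂ) / (ħ : ℂ))) with hF
  have hpos : ∀ ε v : ℝ, 0 < v →
      F ε v = c * ((v : ℂ) ^ n * Complex.exp (-((ε : ℂ) + θ) * v)) := by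
    intro ε v hv
    simp only [hF, abs_of_pos hv, Real.sign_of_pos hv]
    rw [show -((ε : ℂ) + θ) * v = ((-ε * v : ℝ) : ℂ) + -Complex.I * v * p / ħ by
      rw [hθ]; push_cast; ring, Complex.exp_add, Complex.ofReal_exp]
    push_cast; ring
  have hneg : ∀ ε v : ℝ, 0 < v →
      F ε (-v) = c * (-(-1) ^ n * ((v : ℂ) ^ n * Complex.exp (-((ε : ℂ) - θ) * v))) := by
    intro ε v hv
    simp only [hF, abs_neg, abs_of_pos hv, Real.sign_of_neg (neg_neg_of_pos hv)]
    rw [show -((ε : ℂ) - θ) * v = ((-ε * v : ℝ) : ℂ) + -Complex.I * ((-v : ℝ) : ℂ) * p / ħ by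
      rw [hθ]; push_cast; ring, Complex.exp_add, Complex.ofReal_exp]
    push_cast
    rw [neg_pow (v : ℂ)]
    ring
  have hi1 : ∀ ε : ℝ, 0 < ε → IntegrableOn (F ε) (Set.Ioi 0) := fun ε hε =>
    IntegrableOn.congr_fun
      ((integrableOn_pow_mul_cexp n (z := (ε : ℂ) + θ) (by simpa [hθre])).const_mul c)
      (fun v hv => (hpos ε v hv).symm) measurableSet_Ioi
  have hi2 : ∀ ε : ℝ, 0 < ε → IntegrableOn (fun v => F ε (-v)) (Set.Ioi 0) := fun ε hε =>
    IntegrableOn.congr_fun (((integrableOn_pow_mul_cexp n (z := (ε : ℂ) - θ)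
      (by simpa [hθre])).const_mul (-(-1) ^ n)).const_mul c) (fun v hv => (hneg ε v hv).symm) measurableSet_Ioi
  have hi3 : ∀ ε : ℝ, 0 < ε → IntegrableOn (F ε) (Set.Iic 0) := fun ε hε => by
    rw [integrableOn_Iic_iff_integrableOn_Iio]
    have := (show IntegrableOn (fun v => F ε (-v)) (Set.Ioi (-0)) by
      rw [neg_zero]; exact hi2 ε hε).comp_neg_Iio
    simpa using this
  refine ⟨fun ε hε => ?_, ?_⟩
  · rw [← integrableOn_univ, ← Set.Iic_union_Ioi (a := (0 : ℝ))]
    exact (hi3 ε hε).union (hi1 ε hε)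
  have hval : ∀ ε : ℝ, 0 < ε → ∫ v, F ε v = c * (n.factorial / ((ε : ℂ) + θ) ^ (n + 1)) +
      c * (-(-1) ^ n * (n.factorial / ((ε : ℂ) - θ) ^ (n + 1))) := by
    intro ε hε
    rw [← intervalIntegral.integral_Iic_add_Ioi (hi3 ε hε) (hi1 ε hε), add_comm]
    congr 1
    · rw [setIntegral_congr_fun measurableSet_Ioi fun v hv => hpos ε v hv, integral_const_mul,
        integral_pow_mul_cexp n (by simpa [hθre])]
    · have := integral_comp_neg_Ioi 0 (F ε)
      rw [neg_zero] at this
      rw [← this, setIntegral_congr_fun measurableSet_Ioi fun v hv => hneg ε v hv,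
        integral_const_mul, integral_const_mul, integral_pow_mul_cexp n (by simpa [hθre])]
  have hlim : Tendsto (fun ε : ℝ => c * (n.factorial / ((ε : ℂ) + θ) ^ (n + 1)) +
      c * (-(-1) ^ n * (n.factorial / ((ε : ℂ) - θ) ^ (n + 1)))) (𝓝[>] 0)
      (𝓝 (c * (n.factorial / (((0 : ℝ) : ℂ) + θ) ^ (n + 1)) +
        c * (-(-1) ^ n * (n.factorial / (((0 : ℝ) : ℂ) - θ) ^ (n + 1))))) := by
    refine Tendsto.mono_left (ContinuousAt.tendsto ?_) nhdsWithin_le_nhds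
    have h1 : (((0 : ℝ) : ℂ) + θ) ^ (n + 1) ≠ 0 := by simpa using hθ0
    have h2 : (((0 : ℝ) : ℂ) - θ) ^ (n + 1) ≠ 0 := by simpa using hθ0
    fun_prop (disch := assumption)
  have he : c * (2 * (n.factorial / θ ^ (n + 1))) =
      c * (n.factorial / (((0 : ℝ) : ℂ) + θ) ^ (n + 1)) +
        c * (-(-1) ^ n * (n.factorial / (((0 : ℝ) : ℂ) - θ) ^ (n + 1))) := by
    rw [Complex.ofReal_zero, zero_add, zero_sub, neg_pow θ, pow_succ (-1 : ℂ)]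
    have h1 : ((-1 : ℂ) ^ n) ≠ 0 := by simp
    field_simp
    ring
  rw [he]
  exact hlim.congr' (by filter_upwards [self_mem_nhdsWithin] with ε hε using (hval ε hε).symm)

/-! ### Convergence of the momentum expansions. -/

theorem summable_of_mem_invPowSpan {M : ℕ} {U : ℂ⟦X⟧} (hU : IsEntireSeries U) {d : ℕ → ℂ⟦X⟧}
    (hd : d ∈ invPowSpan M U) {u z : ℂ} (hz : ‖2 * evalSeries u U * z‖ < 1) :
    Summable fun m => evalSeries u (d m) * z ^ m := by
  induction hd using AddSubmonoid.closure_induction with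
  | mem d h =>
    obtain ⟨e, k, he, rfl⟩ := h
    rw [← summable_nat_add_iff k]
    have h1 := (summable_choose_mul_geometric_of_norm_lt_one (M + k) hz).mul_left
      (evalSeries u e * z ^ k)
    refine h1.congr fun i => ?_
    simp only [invPow]
    rw [evalSeries_mul he ((hU.pow _).smul _), evalSeries_smul (hU.pow _),
      evalSeries_pow hU, Nat.add_sub_cancel, show M + (i + k) = i + (M + k) by ring]
    ring
  | zero => simp [evalSeries_zero]
  | add d e hd' he' hd he =>
    refine (hd.add he).congr fun m => ?_
    rw [Pi.add_apply, evalSeries_add (isEntireSeries_of_mem_invPowSpan hU hd' m)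
      (isEntireSeries_of_mem_invPowSpan hU he' m)]
    ring

theorem hasSum_moyalTerm_zero {M : ℕ} {U : ℂ⟦X⟧} (hU : IsEntireSeries U) {u z : ℂ}
    (hz : ‖2 * evalSeries u U * z‖ < 1) :
    HasSum (fun m => evalSeries u (moyalTerm M U 0 m) * z ^ m)
      (1 / (1 - 2 * evalSeries u U * z) ^ (M + 1)) := by
  refine (congrArg (HasSum · _) (funext fun m => ?_)).mpr
    (hasSum_choose_mul_geometric_of_norm_lt_one M hz)
  rw [show moyalTerm M U 0 = invPow M U 0 from rfl, invPow, evalSeries_smul (hU.pow _),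
    evalSeries_pow hU, add_zero, Nat.sub_zero, add_comm M m]
  ring

/-! ### The terms of the transform as polynomials in ħ. -/

/-- The common factor of the terms of the Wigner-Weyl transform. -/
def termFactor (M : ℕ) (μ p : ℝ) (c : ℂ) : ℂ :=
  2 * μ / Complex.I * (c * (2 * M + 1).factorial) / (Complex.I * p) ^ (2 * M + 2)

/-- The term with index `2M+1+2m` of the Wigner-Weyl transform, as a polynomial in `ħ`. -/
def rowPoly (M : ℕ) (U : ℂ⟦X⟧) (μ p : ℝ) (c u : ℂ) (m : ℕ) : Polynomial ℂ :=
  ∑ s ∈ Finset.range (m + 1), Polynomial.monomial (2 * M + 1 + 2 * s)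
    (termFactor M μ p c * (μ ^ s : ℂ)⁻¹ *
      (evalSeries u (moyalTerm M U s m) * (-μ / p ^ 2 : ℂ) ^ m))

/-- The terms of the Wigner-Weyl transform, as polynomials in `ħ`. -/
def termPoly (M : ℕ) (U : ℂ⟦X⟧) (μ p : ℝ) (c u : ℂ) : ℕ → Polynomial ℂ :=
  Function.extend (fun m : ℕ => 2 * M + 1 + 2 * m) (rowPoly M U μ p c u) 0

theorem termPoly_apply (M : ℕ) (U : ℂ⟦X⟧) (μ p : ℝ) (c u : ℂ) (m : ℕ) :
    termPoly M U μ p c u (2 * M + 1 + 2 * m) = rowPoly M U μ p c u m :=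
  (rowIndex_injective M).extend_apply _ _ m

theorem termPoly_eq_zero (M : ℕ) (U : ℂ⟦X⟧) (μ p : ℝ) (c u : ℂ) {n : ℕ}
    (h : ∀ m, 2 * M + 1 + 2 * m ≠ n) : termPoly M U μ p c u n = 0 :=
  Function.extend_apply' _ _ _ fun ⟨m, hm⟩ => h m hm

/-- The row factorial cancels n!, and the powers of ħ combine to -1 - 2(m-s) + (2M+2+2m) = 2M+1+2s.
The remaining powers of μ and p assemble into (-μ/p²)^m μ^(-s), so the formal p⁻² becomes -μ/p². -/
theorem eval_termPoly {M : ℕ} {U : ℂ⟦X⟧} (hU : IsEntireSeries U) {ħ μ p : ℝ} (hħ : 0 < ħ)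
    (hμ : 0 < μ) (hp : p ≠ 0) (c u : ℂ) (n : ℕ) :
    (μ : ℂ) / (Complex.I * ħ) *
        evalSeries u (shiftRows M U ((μ / ħ ^ 2 : ℝ) : ℂ) c n) *
        (2 * (n.factorial / (Complex.I * p / ħ) ^ (n + 1))) =
      (termPoly M U μ p c u n).eval (ħ : ℂ) := by
  have hħ' : (ħ : ℂ) ≠ 0 := by exact_mod_cast hħ.ne'
  have hμ' : (μ : ℂ) ≠ 0 := by exact_mod_cast hμ.ne'
  have hp' : (p : ℂ) ≠ 0 := by exact_mod_cast hp
  by_cases hn : ∃ m, 2 * M + 1 + 2 * m = n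
  · obtain ⟨m, rfl⟩ := hn
    have hterm : ∀ s, IsEntireSeries (moyalTerm M U s m) := fun s =>
      isEntireSeries_of_mem_invPowSpan hU (moyalTerm_mem hU s) m
    have hfac : ((2 * M + 1 + 2 * m).factorial : ℂ) ≠ 0 := by
      exact_mod_cast Nat.factorial_ne_zero _
    rw [termPoly_apply, shiftRows_apply, rowPoly, Polynomial.eval_finsetSum, moyalSum,
      evalSeries_smul (IsEntireSeries.sum fun s _ => (hterm s).smul _),
      evalSeries_sum fun s _ => (hterm s).smul _, Finset.mul_sum, Finset.mul_sum, Finset.sum_mul]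
    refine Finset.sum_congr rfl fun s hs => ?_
    rw [evalSeries_smul (hterm s), Polynomial.eval_monomial, termFactor]
    obtain ⟨i, rfl⟩ : ∃ i, m = s + i := ⟨m - s, by have := Finset.mem_range.1 hs; omega⟩
    generalize evalSeries u (moyalTerm M U s (s + i)) = x
    have e1 : (Complex.I * (p : ℂ) / ħ) ^ (2 * M + 1 + 2 * (s + i) + 1) =
        (Complex.I * p) ^ (2 * M + 2) * (-1) ^ (s + i) * (p ^ 2) ^ (s + i) /
          (ħ ^ (2 * M + 2) * (ħ ^ 2) ^ (s + i)) := by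
      rw [show 2 * M + 1 + 2 * (s + i) + 1 = 2 * M + 2 + 2 * (s + i) by ring, div_pow, pow_add,
        pow_mul _ 2 (s + i), mul_pow Complex.I (p : ℂ) 2, Complex.I_sq, mul_pow (-1 : ℂ),
        pow_add (ħ : ℂ), pow_mul (ħ : ℂ) 2 (s + i)]
      ring
    have e2 : ((-1 : ℂ)) ^ (s + i) * (-1) ^ (s + i) = 1 := by rw [← mul_pow]; simp
    have e3 : ((-1 : ℂ)) ^ (s + i) ≠ 0 := by simp
    rw [e1, Nat.add_sub_cancel_left, div_pow (-(μ : ℂ)), neg_pow (μ : ℂ),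
      pow_add (ħ : ℂ) _ (2 * s),
      pow_mul (ħ : ℂ) 2 s]
    push_cast
    rw [div_pow (μ : ℂ), pow_add (μ : ℂ), pow_add ((ħ : ℂ) ^ 2), pow_succ (ħ : ℂ) (2 * M + 1)]
    have hI := Complex.I_ne_zero
    -- The sign is its own inverse; inverting one of its occurrences lets the signs on the two sides
    -- cancel.
    have e4 : ((-1 : ℂ)) ^ (s + i) = ((-1) ^ (s + i))⁻¹ := eq_inv_of_mul_eq_one_left e2
    nth_rewrite 2 [e4]
    generalize ((-1 : ℂ)) ^ (s + i) = y at e3 ⊢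
    field_simp
  · rw [termPoly_eq_zero M U μ p c u fun m h => hn ⟨m, h⟩,
      shiftRows_eq_zero M U _ c fun m h => hn ⟨m, h⟩, evalSeries_zero]
    simp

theorem coeff_rowPoly {M : ℕ} {U : ℂ⟦X⟧} (hU : constantCoeff U = 0) (μ p : ℝ) (c u : ℂ)
    (s m : ℕ) : (rowPoly M U μ p c u m).coeff (2 * M + 1 + 2 * s) =
      termFactor M μ p c * (μ ^ s : ℂ)⁻¹ *
        (evalSeries u (moyalTerm M U s m) * (-μ / p ^ 2 : ℂ) ^ m) := by
  rw [rowPoly, Polynomial.finsetSum_coeff, Finset.sum_eq_single s]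
  · simp
  · intro t _ hts
    rw [Polynomial.coeff_monomial, if_neg (by omega)]
  -- Orders s > m are absent from the polynomial, consistently with the vanishing of D_s at index m.
  · intro hs
    rw [moyalTerm_eq_zero hU (by simpa using hs), evalSeries_zero]
    simp

theorem coeff_rowPoly_eq_zero (M : ℕ) (U : ℂ⟦X⟧) (μ p : ℝ) (c u : ℂ) (m : ℕ) {k : ℕ}
    (hk : ∀ s, 2 * M + 1 + 2 * s ≠ k) : (rowPoly M U μ p c u m).coeff k = 0 := by
  rw [rowPoly, Polynomial.finsetSum_coeff]
  exact Finset.sum_eq_zero fun s _ => by rw [Polynomial.coeff_monomial, if_neg (hk s)]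

theorem hasSum_termPoly_iff (M : ℕ) (U : ℂ⟦X⟧) (μ p : ℝ) (c u : ℂ) {φ : Polynomial ℂ → ℂ}
    (hφ : φ 0 = 0) (a : ℂ) : HasSum (fun n => φ (termPoly M U μ p c u n)) a ↔
      HasSum (fun m => φ (rowPoly M U μ p c u m)) a := by
  rw [← (rowIndex_injective M).hasSum_iff]
  · simp only [Function.comp_def, termPoly_apply]
  · intro n hn
    rw [termPoly_eq_zero M U μ p c u fun m h => hn ⟨m, h⟩, hφ]

theorem hasWignerWeylTerms {M : ℕ} {U : ℂ⟦X⟧} (hU : IsEntireSeries U) (hU0 : constantCoeff U = 0)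
    {ħ μ : ℝ} (hħ : 0 < ħ) (hμ : 0 < μ) (c : ℂ) (q : ℝ) {p : ℝ} (hp : p ≠ 0) :
    HasWignerWeylTerms
      (operatorKernel ħ μ (kernelFactor (rows (shiftRows M U ((μ / ħ ^ 2 : ℝ) : ℂ) c)))) ħ q p
      (fun n => (termPoly M U μ p c ((2 * q : ℝ) : ℂ) n).eval (ħ : ℂ)) := by
  set Λ : ℂ := ((μ / ħ ^ 2 : ℝ) : ℂ) with hΛ
  refine ⟨fun n => μ / (Complex.I * ħ) * evalSeries ((2 * q : ℝ) : ℂ) (shiftRows M U Λ c n),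
    fun v => ?_, fun n => ?_⟩
  · have h := hasSum_rows (isEntireDouble_shiftRows (M := M) hU hU0 Λ c) ((2 * q : ℝ) : ℂ) (v : ℂ)
    have h1 := (h.mul_left ((μ : ℂ) / (Complex.I * ħ))).mul_right (Real.sign v : ℂ)
    rw [operatorKernel, kernelFactor, show q + v / 2 + (q - v / 2) = 2 * q by ring,
      show q + v / 2 - (q - v / 2) = v by ring]
    simpa only [mul_assoc] using h1
  · simp only [← eval_termPoly hU hħ hμ hp]
    exact hasAbelIntegral_pow_mul_sign _ n hħ hp

/-! ### The potential at the origin and linear systems. -/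

theorem IsHalfSeries.constantCoeff {V : ℝ → ℝ} {U : ℂ⟦X⟧} (hU : IsHalfSeries V U)
    (hV0 : V 0 = 0) : PowerSeries.constantCoeff U = 0 := by
  have := hU.eval 0
  rwa [mul_zero, Complex.ofReal_zero, evalSeries_at_zero, hV0, Complex.ofReal_zero,
    coeff_zero_eq_constantCoeff_apply] at this

theorem IsHalfSeries.coeff_eq_zero {V : ℝ → ℝ} {U : ℂ⟦X⟧} (hU : IsHalfSeries V U)
    (hV : IsLinearSystem V) {n : ℕ} (hn : 3 ≤ n) : coeff n U = 0 := by
  obtain ⟨k, b, hkb⟩ := hV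
  have hder : ∀ x : ℝ, evalSeries ((2 * x : ℝ) : ℂ) (d⁄dX ℂ U) * 2 = ((k * x + b : ℝ) : ℂ) := by
    intro x
    have h1 : HasDerivAt (fun z : ℂ => 2 * z) 2 (x : ℂ) := by
      simpa using (hasDerivAt_id (x : ℂ)).const_mul 2
    have h2 := ((hasDerivAt_evalSeries hU.isEntire (2 * (x : ℂ))).comp (x : ℂ) h1).comp_ofReal
    have h3 : (fun y : ℝ => ((fun z => evalSeries z U) ∘ fun z : ℂ => 2 * z) (y : ℂ)) =
        fun y : ℝ => (V y : ℂ) := by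
      funext y
      rw [← hU.eval]
      simp
    rw [h3] at h2
    have h4 : HasDerivAt V (evalSeries (2 * (x : ℂ)) (d⁄dX ℂ U) * 2).re x :=
      Complex.reCLM.hasFDerivAt.comp_hasDerivAt x h2
    rw [← hkb x, h4.deriv, h4.ofReal_comp.unique h2, Complex.ofReal_mul, Complex.ofReal_ofNat]
  -- From U(x) = V(x/2): U'(x) = V'(x/2)/2 = b/2 + (k/4) x.
  set P : Polynomial ℂ := -(Polynomial.C (b / 2 : ℂ) + Polynomial.C (k / 4 : ℂ) * Polynomial.X)
    with hP
  have hf : IsEntireSeries (d⁄dX ℂ U + (P : ℂ⟦X⟧)) :=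
    hU.isEntire.derivative.add (IsEntireSeries.polynomial P)
  have hz := coeff_eq_zero_of_evalSeries_eq_zero (n - 1) hf fun x => by
    rw [evalSeries_add hU.isEntire.derivative (IsEntireSeries.polynomial P),
      evalSeries_polynomial]
    have h := hder (x / 2)
    rw [mul_div_cancel₀ x two_ne_zero] at h
    push_cast at h
    simp only [hP, Polynomial.eval_neg, Polynomial.eval_add, Polynomial.eval_mul, Polynomial.eval_C,
      Polynomial.eval_X]
    linear_combination h / 2
  obtain ⟨i, rfl⟩ : ∃ i, n = i + 3 := ⟨n - 3, by omega⟩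
  rw [map_add, Polynomial.coeff_coe, show i + 3 - 1 = i + 2 by omega, coeff_derivative, hP] at hz
  have hP0 : (-(Polynomial.C (b / 2 : ℂ) + Polynomial.C (k / 4 : ℂ) * Polynomial.X)).coeff (i + 2)
      = 0 := by
    simp
  rw [hP0, add_zero] at hz
  exact (mul_eq_zero.1 hz).resolve_right (by exact_mod_cast (by omega : i + 2 + 1 ≠ 0))

/-- Every source contains Taylor coefficients of U of order at least 3; without them the zero
solution is the only one. -/
theorem moyalTerm_succ_eq_zero (M : ℕ) {U : ℂ⟦X⟧} (hU : ∀ n, 3 ≤ n → coeff n U = 0) (s : ℕ) :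
    moyalTerm M U (s + 1) = 0 := by
  have h1 : ∀ j, oddPart U (2 * (j + 1) + 1) = 0 := fun j => by
    ext i
    simp [oddPart, hU (i + (2 * (j + 1) + 1)) (by omega)]
  rw [moyalTerm_succ]
  refine eq_transportSol (fun m => ?_) fun m => ?_
  · simp [momDeriv_zero, transportSource, Finset.sum_apply, h1]
  · simp

/-! ### The leading coefficient and the two expansions of the transform. -/

/-- The coefficient of the boundary value `T(x,-x)` as a monomial in `2x`. -/
def antidiagCoeff (μ β : ℝ) (M : ℕ) : ℂ :=
  -(Complex.I ^ (2 * M + 1) * (β : ℂ) / (μ : ℂ) ^ (2 * M))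

/-- At z = -μ/p² one has 1 - 2Vz = 2μH/p², so the leading term is (p²/2μH)^(M+1), and H > 0 by
hypothesis. The powers of i and p cancel against those in the antidiagonal data and the Abel
integral. -/
theorem termFactor_mul_eq {V : ℝ → ℝ} {μ : ℝ} (hμ : 0 < μ) (β : ℝ) (M : ℕ) {q p : ℝ}
    (hqp : |V q| < p ^ 2 / (2 * μ)) :
    termFactor M μ p (antidiagCoeff μ β M) *
        (1 / (1 - 2 * (V q : ℂ) * (-μ / p ^ 2)) ^ (M + 1)) =
      ((shiftCoeff μ β (M + 1) V q p : ℝ) : ℂ) := by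
  have hp : p ≠ 0 := by
    rintro rfl
    have := abs_nonneg (V q)
    simp at hqp
    linarith
  have hH : hamiltonian μ V q p ≠ 0 := by
    have := (abs_lt.1 hqp).1
    rw [hamiltonian]
    linarith
  have hμ' : (μ : ℂ) ≠ 0 := by exact_mod_cast hμ.ne'
  have hp' : (p : ℂ) ≠ 0 := by exact_mod_cast hp
  have hH' : ((hamiltonian μ V q p : ℝ) : ℂ) ≠ 0 := by exact_mod_cast hH
  have e1 : 1 - 2 * (V q : ℂ) * (-μ / p ^ 2) =
      2 * μ * ((hamiltonian μ V q p : ℝ) : ℂ) / p ^ 2 := by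
    rw [hamiltonian]
    push_cast
    field_simp
    ring
  have e2 : (Complex.I * (p : ℂ)) ^ (2 * M + 2) =
      Complex.I ^ (2 * M + 1) * Complex.I * (p ^ 2) ^ (M + 1) := by
    rw [mul_pow, ← pow_mul, ← pow_succ]
    ring_nf
  rw [e1, termFactor, antidiagCoeff, e2, shiftCoeff, show 2 * (M + 1) - 1 = 2 * M + 1 by omega,
    Nat.add_sub_cancel, div_pow, mul_pow, mul_pow]
  have hI := Complex.I_ne_zero
  push_cast
  rw [one_div_pow]
  generalize ((hamiltonian μ V q p : ℝ) : ℂ) = H at hH' ⊢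
  field_simp
  rw [Complex.I_sq]
  ring

section Transform

variable {V : ℝ → ℝ} {U : ℂ⟦X⟧} {μ q p : ℝ}

theorem norm_mul_lt_one (hU : IsHalfSeries V U) (hμ : 0 < μ) (hqp : |V q| < p ^ 2 / (2 * μ)) :
    ‖2 * evalSeries ((2 * q : ℝ) : ℂ) U * (-μ / p ^ 2 : ℂ)‖ < 1 := by
  have hp : 0 < p ^ 2 := by
    have h1 := (abs_nonneg (V q)).trans_lt hqp
    rwa [lt_div_iff₀ (by positivity), zero_mul] at h1
  rw [hU.eval, show 2 * (V q : ℂ) * (-μ / p ^ 2) = ((2 * V q * (-μ / p ^ 2) : ℝ) : ℂ) by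
    push_cast; ring, Complex.norm_real, Real.norm_eq_abs, abs_mul, abs_mul, abs_div, abs_neg,
    abs_of_pos hμ, abs_of_pos hp, abs_two]
  rw [lt_div_iff₀ (by positivity)] at hqp
  rw [mul_div_assoc', div_lt_one hp]
  linarith

theorem hasSum_leading (hU : IsHalfSeries V U) (hμ : 0 < μ) (β : ℝ) (M : ℕ)
    (hqp : |V q| < p ^ 2 / (2 * μ)) :
    HasSum (fun m => termFactor M μ p (antidiagCoeff μ β M) *
        (evalSeries ((2 * q : ℝ) : ℂ) (moyalTerm M U 0 m) * (-μ / p ^ 2 : ℂ) ^ m))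
      ((shiftCoeff μ β (M + 1) V q p : ℝ) : ℂ) := by
  rw [← termFactor_mul_eq hμ β M hqp, ← hU.eval q]
  exact (hasSum_moyalTerm_zero hU.isEntire (norm_mul_lt_one hU hμ hqp)).mul_left _

theorem hasWignerWeyl_of_linear (hU : IsHalfSeries V U) (hV0 : V 0 = 0) (hV : IsLinearSystem V)
    (hμ : 0 < μ) (β : ℝ) (M : ℕ) (hqp : |V q| < p ^ 2 / (2 * μ)) {ħ : ℝ} (hħ : 0 < ħ) (hp : p ≠ 0) :
    HasWignerWeyl (operatorKernel ħ μ
      (kernelFactor (rows (shiftRows M U ((μ / ħ ^ 2 : ℝ) : ℂ) (antidiagCoeff μ β M))))) ħ q p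
      ((shiftCoeff μ β (M + 1) V q p * ħ ^ (2 * M + 1) : ℝ) : ℂ) := by
  refine ⟨_, hasWignerWeylTerms hU.isEntire (hU.constantCoeff hV0) hħ hμ _ q hp, ?_⟩
  rw [hasSum_termPoly_iff (φ := fun P => P.eval (ħ : ℂ)) M U μ p _ _ (by simp)]
  have h := (hasSum_leading hU hμ β M hqp).mul_right ((ħ : ℂ) ^ (2 * M + 1))
  push_cast
  refine (congrArg (HasSum · _) (funext fun m => ?_)).mpr h
  -- Isolates the order s = 0, the only one that survives for a linear system.
  rw [rowPoly, Finset.sum_range_succ']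
  simp [moyalTerm_succ_eq_zero M (fun n hn => hU.coeff_eq_zero hV hn), evalSeries_zero]

/-- Only the exponents 2M+1+2s occur. Below 2M+3 the leading one is therefore alone, which gives the
gain of two powers. -/
theorem exists_hasWignerWeylExpansion (hU : IsHalfSeries V U) (hV0 : V 0 = 0)
    (hμ : 0 < μ) (β : ℝ) (M : ℕ) (hqp : |V q| < p ^ 2 / (2 * μ)) (hp : p ≠ 0) :
    ∃ W : PowerSeries ℂ,
      HasWignerWeylExpansion (fun ħ => operatorKernel ħ μ
        (kernelFactor (rows (shiftRows M U ((μ / ħ ^ 2 : ℝ) : ℂ) (antidiagCoeff μ β M))))) q p W ∧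
      (PowerSeries.X : PowerSeries ℂ) ^ (2 * M + 3) ∣
        W - PowerSeries.monomial (2 * M + 1) ((shiftCoeff μ β (M + 1) V q p : ℝ) : ℂ) := by
  have hU0 := hU.constantCoeff hV0
  set c := antidiagCoeff μ β M
  set u : ℂ := ((2 * q : ℝ) : ℂ)
  have hφ : ∀ k : ℕ, (0 : Polynomial ℂ).coeff k = 0 := fun k => Polynomial.coeff_zero k
  have hzero : ∀ k, (∀ s, 2 * M + 1 + 2 * s ≠ k) →
      HasSum (fun n => (termPoly M U μ p c u n).coeff k) 0 := fun k hk => by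
    rw [hasSum_termPoly_iff (φ := fun P => P.coeff k) M U μ p c u (hφ k)]
    simp only [coeff_rowPoly_eq_zero M U μ p c u _ hk]
    exact hasSum_zero
  have hlead : HasSum (fun n => (termPoly M U μ p c u n).coeff (2 * M + 1))
      ((shiftCoeff μ β (M + 1) V q p : ℝ) : ℂ) := by
    rw [hasSum_termPoly_iff (φ := fun P => P.coeff (2 * M + 1)) M U μ p c u (hφ _)]
    refine (congrArg (HasSum · _) (funext fun m => ?_)).mpr (hasSum_leading hU hμ β M hqp)
    rw [show 2 * M + 1 = 2 * M + 1 + 2 * 0 from rfl, coeff_rowPoly hU0, pow_zero, inv_one, mul_one]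
  have hsum : ∀ k, Summable fun n => (termPoly M U μ p c u n).coeff k := fun k => by
    by_cases hk : ∃ s, 2 * M + 1 + 2 * s = k
    · obtain ⟨s, rfl⟩ := hk
      have h := (summable_of_mem_invPowSpan hU.isEntire (moyalTerm_mem (M := M) hU.isEntire s)
        (norm_mul_lt_one hU hμ hqp)).mul_left (termFactor M μ p c * (μ ^ s : ℂ)⁻¹)
      refine ((hasSum_termPoly_iff (φ := fun P => P.coeff (2 * M + 1 + 2 * s)) M U μ p c u (hφ _)
        _).2 ?_).summable (a := ∑' m, termFactor M μ p c * (μ ^ s : ℂ)⁻¹ *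
          (evalSeries u (moyalTerm M U s m) * (-μ / p ^ 2 : ℂ) ^ m))
      simp only [coeff_rowPoly hU0]
      exact h.hasSum
    · exact (hzero k fun s h => hk ⟨s, h⟩).summable
  refine ⟨PowerSeries.mk fun k => ∑' n, (termPoly M U μ p c u n).coeff k,
    ⟨termPoly M U μ p c u, fun ħ hħ => hasWignerWeylTerms hU.isEntire hU0 hħ hμ c q hp,
      fun k => by rw [coeff_mk]; exact (hsum k).hasSum⟩, ?_⟩
  rw [X_pow_dvd_iff]
  intro k hk
  rw [map_sub, coeff_mk, coeff_monomial]
  split_ifs with h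
  · rw [h, hlead.tsum_eq, sub_self]
  · rw [(hzero k fun s hs => by omega).tsum_eq, sub_zero]

end Transform

/-! ### Solutions with the prescribed boundary values. -/

/-- On the diagonal u = x + y = 2x, so the value x/2 is the series X/4 at u. -/
theorem diagData_eq (x : ℝ) :
    evalSeries ((2 * x : ℝ) : ℂ)
      ((Polynomial.C (1 / 4 : ℂ) * Polynomial.X : Polynomial ℂ) : ℂ⟦X⟧) = diagData x := by
  rw [evalSeries_polynomial, diagData]
  simp
  ring

theorem isTimeKernelSolution_timeOfArrival {V : ℝ → ℝ} {U : ℂ⟦X⟧} (hU : IsHalfSeries V U)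
    {ħ μ : ℝ} (hħ : 0 < ħ) (hμ : 0 < μ) :
    IsTimeKernelSolution ħ μ V diagData (fun _ => 0)
      (kernelFactor (rows (goursatRows ((μ / ħ ^ 2 : ℝ) : ℂ) (oddPart U)
        ((Polynomial.C (1 / 4 : ℂ) * Polynomial.X : Polynomial ℂ) : ℂ⟦X⟧)))) := by
  have h := isTimeKernelSolution_kernelFactor hħ hμ hU
    (isEntireDouble_goursatRows ((μ / ħ ^ 2 : ℝ) : ℂ) hU.isEntire
      (IsEntireSeries.polynomial (Polynomial.C (1 / 4 : ℂ) * Polynomial.X)) (by simp))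
    (isGoursatSeries_goursatRows _ _ _)
  have h0 : goursatRows ((μ / ħ ^ 2 : ℝ) : ℂ) (oddPart U)
      ((Polynomial.C (1 / 4 : ℂ) * Polynomial.X : Polynomial ℂ) : ℂ⟦X⟧) 0 = _ :=
    recursionSeq_zero _ _
  simp only [h0, diagData_eq] at h
  convert h using 2 with x
  rw [tsum_congr fun n => by rw [rows_goursatRows_zero _ _ (by simp), zero_mul], tsum_zero]

theorem isTimeKernelSolution_shift {V : ℝ → ℝ} {U : ℂ⟦X⟧} (hU : IsHalfSeries V U)
    (hV0 : V 0 = 0) {ħ μ : ℝ} (hħ : 0 < ħ) (hμ : 0 < μ) (β : ℝ) (M : ℕ) :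
    IsTimeKernelSolution ħ μ V (fun _ => 0) (antidiagData μ β (M + 1))
      (kernelFactor (rows (shiftRows M U ((μ / ħ ^ 2 : ℝ) : ℂ) (antidiagCoeff μ β M)))) := by
  have hU0 := hU.constantCoeff hV0
  have h := isTimeKernelSolution_kernelFactor hħ hμ hU
    (isEntireDouble_shiftRows (M := M) hU.isEntire hU0 ((μ / ħ ^ 2 : ℝ) : ℂ) (antidiagCoeff μ β M))
    (isGoursatSeries_shiftRows hU0 _ _)
  convert h using 2 with x x
  · rw [shiftRows_eq_zero M U _ _ fun m => by omega, evalSeries_zero]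
  · rw [tsum_eq_single (2 * M + 1) fun n hn => by
      rw [rows_shiftRows_zero hU0, if_neg hn, zero_mul], rows_shiftRows_zero hU0, if_pos rfl,
      antidiagData, antidiagCoeff, show 2 * (M + 1) - 1 = 2 * M + 1 by omega, Nat.add_sub_cancel]
    push_cast
    ring

end TimeKernel

end

theorem mainTheorem3 (V : ℝ → ℝ) (hV : IsEntirePotential V) (hV0 : V 0 = 0)
    (μ : ℝ) (hμ : 0 < μ) (β : ℝ) (N : ℕ) (hN : 1 ≤ N) :
    ∃ T T_TOA T_C : ℝ → ℝ → ℝ → ℂ,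
      (∀ ħ : ℝ, 0 < ħ →
        IsTheTimeKernelSolution ħ μ V diagData (antidiagData μ β N) (T ħ) ∧
        IsTimeOfArrivalKernel ħ μ V (T_TOA ħ) ∧
        HasKernelPowerSeries (T ħ) ∧ HasKernelPowerSeries (T_TOA ħ) ∧
        ∀ x y : ℝ, T ħ x y = T_TOA ħ x y + T_C ħ x y) ∧
      (IsLinearSystem V → ∀ ħ q p : ℝ, 0 < ħ → |V q| < p ^ 2 / (2 * μ) →
        HasWignerWeyl (operatorKernel ħ μ (T_C ħ)) ħ q p
          ((shiftCoeff μ β N V q p * ħ ^ (2 * N - 1) : ℝ) : ℂ)) ∧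
      (∀ q p : ℝ, |V q| < p ^ 2 / (2 * μ) →
        ∃ W : PowerSeries ℂ,
          HasWignerWeylExpansion (fun ħ => operatorKernel ħ μ (T_C ħ)) q p W ∧
          (PowerSeries.X : PowerSeries ℂ) ^ (2 * N + 1) ∣
            W - PowerSeries.monomial (2 * N - 1) ((shiftCoeff μ β N V q p : ℝ) : ℂ)) := by
  obtain ⟨U, hU⟩ := TimeKernel.exists_isHalfSeries hV
  obtain ⟨M, rfl⟩ : ∃ M, N = M + 1 := ⟨N - 1, by omega⟩
  have hU0 := hU.constantCoeff hV0
  have hp : ∀ q p : ℝ, |V q| < p ^ 2 / (2 * μ) → p ≠ 0 := by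
    rintro q p h rfl
    have := abs_nonneg (V q)
    simp at h
    linarith
  set α : ℝ → ℕ × ℕ → ℂ := fun ħ =>
    TimeKernel.rows (TimeKernel.goursatRows ((μ / ħ ^ 2 : ℝ) : ℂ) (TimeKernel.oddPart U)
      ((Polynomial.C (1 / 4 : ℂ) * Polynomial.X : Polynomial ℂ) : PowerSeries ℂ)) with hα
  set γ : ℝ → ℕ × ℕ → ℂ := fun ħ =>
    TimeKernel.rows (TimeKernel.shiftRows M U ((μ / ħ ^ 2 : ℝ) : ℂ)
      (TimeKernel.antidiagCoeff μ β M)) with hγ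
  have hαE : ∀ ħ, TimeKernel.IsEntireDouble (α ħ) := fun ħ =>
    TimeKernel.isEntireDouble_goursatRows _ hU.isEntire
      (TimeKernel.IsEntireSeries.polynomial _) (by simp)
  have hγE : ∀ ħ, TimeKernel.IsEntireDouble (γ ħ) := fun ħ =>
    TimeKernel.isEntireDouble_shiftRows hU.isEntire hU0 _ _
  have hsum : ∀ ħ x y, TimeKernel.kernelFactor (fun k => α ħ k + γ ħ k) x y =
      TimeKernel.kernelFactor (α ħ) x y + TimeKernel.kernelFactor (γ ħ) x y := fun ħ x y =>
    TimeKernel.evalDouble_add (hαE ħ) (hγE ħ) _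
  -- T is built from the sum of the two coefficient families, so the splitting into T_TOA and T_C
  -- and the power series of T come from additivity.
  refine ⟨fun ħ => TimeKernel.kernelFactor fun k => α ħ k + γ ħ k,
    fun ħ => TimeKernel.kernelFactor (α ħ), fun ħ => TimeKernel.kernelFactor (γ ħ),
    fun ħ hħ => ⟨?_, ?_, ?_, ?_, hsum ħ⟩, fun hlin ħ q p hħ hqp => ?_, fun q p hqp => ?_⟩
  · refine TimeKernel.isTheTimeKernelSolution hħ hμ hU.continuous ?_
    have h := TimeKernel.isTimeKernelSolution_add
      (TimeKernel.isTimeKernelSolution_timeOfArrival hU hħ hμ)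
      (TimeKernel.isTimeKernelSolution_shift hU hV0 hħ hμ β M) 1
    simp only [one_mul, mul_zero, add_zero, zero_add] at h
    convert h using 3 with x y
    exact hsum ħ x y
  · exact TimeKernel.isTheTimeKernelSolution hħ hμ hU.continuous
      (TimeKernel.isTimeKernelSolution_timeOfArrival hU hħ hμ)
  · exact TimeKernel.hasKernelPowerSeries_kernelFactor ((hαE ħ).add (hγE ħ))
  · exact TimeKernel.hasKernelPowerSeries_kernelFactor (hαE ħ)
  · exact TimeKernel.hasWignerWeyl_of_linear hU hV0 hlin hμ β M hqp hħ (hp q p hqp)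
  · exact TimeKernel.exists_hasWignerWeylExpansion hU hV0 hμ β M hqp (hp q p hqp)
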